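/- Let $\epsilon\in(0,1)$ and let $X$ be a real random variable such that, for some $q>0$, $\log P(X\ge x)\sim -q x^{1-\epsilon}$ as $x\to\infty$, with $E[|X|^{2+\gamma}]<\infty$ for some $\gamma>0$, $E[X]=0$ and $\mathrm{Var}(X)=\sigma^2$. Let $X_1,X_2,\dots$ be i.i.d. copies of $X$, $S_n=X_1+\dots+X_n$, let $C>0$ and $x_n=Cn^{1/(1+\epsilon)}$. Then $$\lim_{n\to\infty}\frac{n}{x_n^2}\log P(S_n\ge x_n)=-J(C),\qquad J(C)=\inf_{0\le t\le 1}f(t),\qquad f(t)=\frac{q(1-t)^{1-\epsilon}}{C^{1+\epsilon}}+\frac{t^2}{2\sigma^2}.$$ Moreover, put $C_\epsilon=(1+\epsilon)\bigl(q\sigma^2(2\epsilon)^{-\epsilon}\bigr)^{1/(1+\epsilon)}$. If $C\le C_\epsilon$, then $J(C)=\frac{1}{2\sigma^2}$. If $C>C_\epsilon$, then the equation $$t(1-t)^{\epsilon}=\frac{(1-\epsilon)q\sigma^2}{C^{1+\epsilon}}$$ has exactly two roots in $[0,1]$, and $J(C)=f(t(C))=\frac{q(1-t(C))^{1-\epsilon}}{C^{1+\epsilon}}+\frac{t(C)^2}{2\sigma^2}$,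 where $t(C)$ is the smaller of these two roots. -/

import Mathlib

open MeasureTheory ProbabilityTheory Filter Topology Asymptotics

namespace WeibullLD

noncomputable section

/-- The function `f(t) = q (1 - t)^(1 - ε) / C^(1 + ε) + t² / (2 σ²)`. -/
def costFun (ε q σ C t : ℝ) : ℝ :=
  q * (1 - t) ^ (1 - ε) / C ^ (1 + ε) + t ^ 2 / (2 * σ ^ 2)

/-- The rate function `J(C)`: the infimum of `f` over `[0, 1]`. -/
def rate (ε q σ C : ℝ) : ℝ :=
  sInf (costFun ε q σ C '' Set.Icc 0 1)

/-- The critical constant `C_ε = (1 + ε) (q σ² (2 ε)^(-ε))^(1 / (1 + ε))`. -/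
def critConst (ε q σ : ℝ) : ℝ :=
  (1 + ε) * (q * σ ^ 2 * (2 * ε) ^ (-ε)) ^ (1 / (1 + ε))

/-- The roots in `[0, 1]` of `t (1 - t)^ε = (1 - ε) q σ² / C^(1 + ε)`. -/
def critRoots (ε q σ C : ℝ) : Set ℝ :=
  {t | t ∈ Set.Icc (0 : ℝ) 1 ∧ t * (1 - t) ^ ε = (1 - ε) * q * σ ^ 2 / C ^ (1 + ε)}

/-- The deviation level `x_n = C n^(1 / (1 + ε))`. -/
def level (ε C : ℝ) (n : ℕ) : ℝ :=
  C * (n : ℝ) ^ (1 / (1 + ε))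

end

end WeibullLD

/-!
A sum of `n` variables with tail `exp (-q x^(1 - ε))` reaches the level `x_n = C n^(1 / (1 + ε))` by
a combination of one big jump of size `(1 - t) x_n` and a Gaussian deviation `t x_n` of the other
summands. The level is chosen so that both costs are of the order of the speed `x_n² / n`: the jump
costs `q (1 - t)^(1 - ε) / C^(1 + ε)` and the Gaussian deviation `t² / (2 σ²)` times the speed. The
rate is the minimum over `t` of the total cost `f(t)`.

*Lower bound* (`eventually_exp_le_sumTail`). The tails of the partial sums are supermultiplicative
(`sumTail_mul_le`). For the Gaussian part no exponential moments are needed: the sum is cut into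
`k ≍ x_n² / n` blocks of length `m → ∞`, each block is required to exceed `a √m`, the central limit
theorem bounds the probability of this from below, and finally `a → ∞`
(`exists_blocks_exp_le_sumTail`).

*Upper bound* (`eventually_sumTail_le_exp`). The summands are divided into those below and those
above `η x_n`. A joint Chernoff bound with an exponent that is linear with slope `θ x_n / n` for the
small ones and `q' y^(1 - ε)`, `q' < q`, for the big ones controls both parts at once
(`eventually_measureReal_smallSum_bigSum_le`). For small `η` the linear exponent stays below
`q' y^(1 - ε)`, so a single dominated convergence argument, with the integrable bound
`X² exp (q' (X⁺)^(1 - ε))`, gives the expansion `1 + (θ x_n / n)² σ² / 2` of the exponential moment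
(`tendsto_integral_exp_truncExponent`). Subadditivity of `y^(1 - ε)` replaces the big summands by
their sum, and the event is covered by finitely many cells, `j / N` being the share of the small
summands and `θ = (j / N) / σ²` the optimal slope there.

*Variational problem.* The comparison of `f` with `f(1) = 1 / (2 σ²)` reduces to the maximum of
`(1 + t) (1 - t)^ε`, which weighted AM-GM gives (`one_add_mul_one_sub_rpow_le`), and the position of
the minimum to the monotonicity of `t (1 - t)^ε` on either side of `1 / (1 + ε)`, since the sign of
`f'` is that of `t (1 - t)^ε` minus a constant.
-/

namespace WeibullLD

/-! ### The variational problem for the rate function -/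

section Variational

variable {ε q σ C t : ℝ}

lemma continuous_costFun (hε1 : ε < 1) : Continuous (costFun ε q σ C) := by
  unfold costFun
  have : Continuous fun t : ℝ => (1 - t) ^ (1 - ε) :=
    (continuous_const.sub continuous_id).rpow_const fun _ => Or.inr (by linarith)
  fun_prop

lemma rate_le_costFun (hε1 : ε < 1) (ht : t ∈ Set.Icc (0 : ℝ) 1) :
    rate ε q σ C ≤ costFun ε q σ C t :=
  csInf_le (isCompact_Icc.image (continuous_costFun hε1)).bddBelow ⟨t, ht, rfl⟩

lemma exists_costFun_eq_rate (hε1 : ε < 1) :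
    ∃ t ∈ Set.Icc (0 : ℝ) 1, costFun ε q σ C t = rate ε q σ C :=
  (isCompact_Icc.image (continuous_costFun hε1)).sInf_mem
    ((Set.nonempty_Icc.2 zero_le_one).image _)

lemma costFun_one (hε1 : ε < 1) : costFun ε q σ C 1 = 1 / (2 * σ ^ 2) := by
  have : (0 : ℝ) ^ (1 - ε) = 0 := Real.zero_rpow (by linarith)
  simp [costFun, this]

/-- The sign of `f(t) - f(1)` is that of `2 q σ² / C^(1 + ε) - (1 + t) (1 - t)^ε`. -/
lemma costFun_sub_costFun_one (hσ : σ ≠ 0) (hε1 : ε < 1) (ht : t < 1) :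
    costFun ε q σ C t - costFun ε q σ C 1 = (1 - t) ^ (1 - ε) / (2 * σ ^ 2) *
      (2 * (q * σ ^ 2 / C ^ (1 + ε)) - (1 + t) * (1 - t) ^ ε) := by
  have h : (1 - t) ^ (1 - ε) * (1 - t) ^ ε = 1 - t := by
    rw [← Real.rpow_add (by linarith)]; simp
  have h2 : (1 - t) ^ (1 - ε) / (2 * σ ^ 2) *
      (2 * (q * σ ^ 2 / C ^ (1 + ε)) - (1 + t) * (1 - t) ^ ε) =
      (1 - t) ^ (1 - ε) / (2 * σ ^ 2) * (2 * (q * σ ^ 2 / C ^ (1 + ε))) -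
      (1 + t) * ((1 - t) ^ (1 - ε) * (1 - t) ^ ε) / (2 * σ ^ 2) := by ring
  rw [h2, h, costFun_one hε1, costFun]
  field_simp
  ring

/-- Weighted AM-GM; equality holds at `t = (1 - ε) / (1 + ε)`. -/
lemma one_add_mul_one_sub_rpow_le (hε0 : 0 < ε) (h0 : -1 ≤ t) (h1 : t ≤ 1) :
    (1 + t) * (1 - t) ^ ε ≤ 2 * ((2 * ε) ^ ε / (1 + ε) ^ (1 + ε)) := by
  have key := Real.geom_mean_le_arith_mean2_weighted (w₁ := 1 / (1 + ε)) (w₂ := ε / (1 + ε))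
    (p₁ := 1 + t) (p₂ := (1 - t) / ε) (by positivity) (by positivity) (by linarith)
    (div_nonneg (by linarith) hε0.le) (by field_simp)
  have hr : 1 / (1 + ε) * (1 + t) + ε / (1 + ε) * ((1 - t) / ε) = 2 / (1 + ε) := by
    field_simp; ring
  rw [hr] at key
  have hA : 0 ≤ 1 + t := by linarith
  have hB : 0 ≤ (1 - t) / ε := div_nonneg (by linarith) hε0.le
  have key2 := Real.rpow_le_rpow (by positivity) key (by linarith : 0 ≤ 1 + ε)
  rw [Real.mul_rpow (by positivity) (by positivity), ← Real.rpow_mul hA, ← Real.rpow_mul hB,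
    show 1 / (1 + ε) * (1 + ε) = 1 by field_simp, show ε / (1 + ε) * (1 + ε) = ε by field_simp,
    Real.rpow_one, Real.div_rpow (by linarith) hε0.le,
    Real.div_rpow (by norm_num) (by linarith), Real.rpow_add (by norm_num : (0:ℝ) < 2),
    Real.rpow_one] at key2
  rw [Real.mul_rpow (by norm_num) hε0.le]
  have he : 0 < ε ^ ε := Real.rpow_pos_of_pos hε0 _
  calc (1 + t) * (1 - t) ^ ε = (1 + t) * ((1 - t) ^ ε / ε ^ ε) * ε ^ ε := by field_simp
    _ ≤ 2 * 2 ^ ε / (1 + ε) ^ (1 + ε) * ε ^ ε := mul_le_mul_of_nonneg_right key2 he.le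
    _ = _ := by ring

lemma one_add_mul_one_sub_rpow_eq (hε0 : 0 < ε) :
    (1 + (1 - ε) / (1 + ε)) * (1 - (1 - ε) / (1 + ε)) ^ ε
      = 2 * ((2 * ε) ^ ε / (1 + ε) ^ (1 + ε)) := by
  have h1 : 1 + (1 - ε) / (1 + ε) = 2 / (1 + ε) := by field_simp; ring
  have h2 : 1 - (1 - ε) / (1 + ε) = 2 * ε / (1 + ε) := by field_simp; ring
  rw [h1, h2, Real.div_rpow (by positivity) (by positivity), Real.rpow_add (by positivity),
    Real.rpow_one]
  field_simp

lemma le_critConst_iff (hε0 : 0 < ε) (hq : 0 < q) (hσ : σ ≠ 0) (hC : 0 < C) :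
    C ≤ critConst ε q σ ↔ (2 * ε) ^ ε / (1 + ε) ^ (1 + ε) ≤ q * σ ^ 2 / C ^ (1 + ε) := by
  have hp : 0 < 1 + ε := by linarith
  have h2 : 0 < (2 * ε) ^ ε := by positivity
  have hD : 0 < q * σ ^ 2 * (2 * ε) ^ (-ε) := by positivity
  have hcc : 0 ≤ critConst ε q σ := by unfold critConst; positivity
  rw [← Real.rpow_le_rpow_iff hC.le hcc hp, critConst, Real.mul_rpow hp.le (by positivity),
    ← Real.rpow_mul hD.le, one_div_mul_cancel hp.ne', Real.rpow_one, Real.rpow_neg (by positivity),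
    div_le_div_iff₀ (by positivity) (by positivity), ← div_eq_mul_inv, mul_div_assoc',
    le_div_iff₀ h2]
  constructor <;> intro h <;> linarith

lemma rate_eq_of_le_critConst (hε0 : 0 < ε) (hε1 : ε < 1) (hq : 0 < q) (hσ : σ ≠ 0) (hC : 0 < C)
    (h : C ≤ critConst ε q σ) : rate ε q σ C = 1 / (2 * σ ^ 2) := by
  rw [le_critConst_iff hε0 hq hσ hC] at h
  rw [← costFun_one (q := q) (C := C) hε1]
  refine le_antisymm (rate_le_costFun hε1 (by simp)) ?_
  obtain ⟨t, ⟨ht0, ht1⟩, ht⟩ := exists_costFun_eq_rate (q := q) (σ := σ) (C := C) hε1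
  rw [← ht]
  rcases ht1.eq_or_lt with rfl | ht1
  · exact le_rfl
  rw [← sub_nonneg, costFun_sub_costFun_one hσ hε1 ht1]
  have := one_add_mul_one_sub_rpow_le hε0 (by linarith) ht1.le
  have h3 : 0 ≤ (1 - t) ^ (1 - ε) := Real.rpow_nonneg (by linarith) _
  exact mul_nonneg (by positivity) (by linarith)

lemma rate_lt_of_critConst_lt (hε0 : 0 < ε) (hε1 : ε < 1) (hq : 0 < q) (hσ : σ ≠ 0) (hC : 0 < C)
    (h : critConst ε q σ < C) : rate ε q σ C < costFun ε q σ C 1 := by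
  rw [← not_le, le_critConst_iff hε0 hq hσ hC, not_le] at h
  have ht1 : (1 - ε) / (1 + ε) < 1 := by rw [div_lt_one (by linarith)]; linarith
  have ht0 : 0 ≤ (1 - ε) / (1 + ε) := div_nonneg (by linarith) (by linarith)
  refine (rate_le_costFun hε1 ⟨ht0, ht1.le⟩).trans_lt ?_
  rw [← sub_neg, costFun_sub_costFun_one hσ hε1 ht1, one_add_mul_one_sub_rpow_eq hε0]
  have h3 : 0 < (1 - (1 - ε) / (1 + ε)) ^ (1 - ε) := Real.rpow_pos_of_pos (by linarith) _
  exact mul_neg_of_pos_of_neg (by positivity) (by linarith)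

lemma hasDerivAt_mul_one_sub_rpow (ht : t < 1) :
    HasDerivAt (fun t : ℝ => t * (1 - t) ^ ε) ((1 - t) ^ (ε - 1) * (1 - (1 + ε) * t)) t := by
  have h1 : HasDerivAt (fun t : ℝ => 1 - t) (-1) t := by
    simpa using (hasDerivAt_id t).const_sub 1
  have h2 := (hasDerivAt_id t).mul (h1.rpow_const (p := ε) (Or.inl (by linarith : 1 - t ≠ 0)))
  refine h2.congr_deriv ?_
  have : (1 - t) ^ ε = (1 - t) ^ (ε - 1) * (1 - t) := by
    rw [Real.rpow_sub_one (by linarith), div_mul_cancel₀ _ (by linarith)]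
  simp only [id]
  rw [this]
  ring

lemma hasDerivAt_costFun (hσ : σ ≠ 0) (ht : t < 1) :
    HasDerivAt (costFun ε q σ C) ((1 - t) ^ (-ε) / σ ^ 2 *
      (t * (1 - t) ^ ε - (1 - ε) * q * σ ^ 2 / C ^ (1 + ε))) t := by
  have h1 : HasDerivAt (fun t : ℝ => 1 - t) (-1) t := by
    simpa using (hasDerivAt_id t).const_sub 1
  have h2 := (((h1.rpow_const (p := 1 - ε) (Or.inl (by linarith : 1 - t ≠ 0))).const_mul
    q).div_const (C ^ (1 + ε))).add (((hasDerivAt_id t).pow 2).div_const (2 * σ ^ 2))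
  refine h2.congr_deriv ?_
  have h3 : (1 - t) ^ (-ε) * (1 - t) ^ ε = 1 := by
    rw [← Real.rpow_add (by linarith)]; simp
  have h4 : (1 - t) ^ (-ε) / σ ^ 2 * (t * (1 - t) ^ ε - (1 - ε) * q * σ ^ 2 / C ^ (1 + ε)) =
    ((1 - t) ^ (-ε) * (1 - t) ^ ε) * t / σ ^ 2
      - (1 - t) ^ (-ε) / σ ^ 2 * ((1 - ε) * q * σ ^ 2 / C ^ (1 + ε)) := by ring
  rw [h4, h3, show 1 - ε - 1 = -ε by ring]
  simp only [id]
  field_simp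
  ring

lemma continuous_mul_one_sub_rpow (hε0 : 0 < ε) :
    Continuous fun t : ℝ => t * (1 - t) ^ ε :=
  continuous_id.mul ((continuous_const.sub continuous_id).rpow_const fun _ => Or.inr hε0.le)

lemma strictMonoOn_mul_one_sub_rpow (hε0 : 0 < ε) :
    StrictMonoOn (fun t : ℝ => t * (1 - t) ^ ε) (Set.Icc 0 (1 / (1 + ε))) := by
  refine strictMonoOn_of_deriv_pos (convex_Icc _ _)
    (continuous_mul_one_sub_rpow hε0).continuousOn fun t ht => ?_
  rw [interior_Icc, Set.mem_Ioo, lt_div_iff₀ (by linarith)] at ht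
  have h1 : t < 1 := by nlinarith
  rw [(hasDerivAt_mul_one_sub_rpow h1).deriv]
  exact mul_pos (Real.rpow_pos_of_pos (by linarith) _) (by linarith)

lemma strictAntiOn_mul_one_sub_rpow (hε0 : 0 < ε) :
    StrictAntiOn (fun t : ℝ => t * (1 - t) ^ ε) (Set.Icc (1 / (1 + ε)) 1) := by
  refine strictAntiOn_of_deriv_neg (convex_Icc _ _)
    (continuous_mul_one_sub_rpow hε0).continuousOn fun t ht => ?_
  rw [interior_Icc, Set.mem_Ioo, div_lt_iff₀ (by linarith)] at ht
  rw [(hasDerivAt_mul_one_sub_rpow ht.2).deriv]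
  exact mul_neg_of_pos_of_neg (Real.rpow_pos_of_pos (by linarith) _) (by linarith)

/-- Above the critical constant the level `(1 - ε) q σ² / C^(1 + ε)` is below the maximum
`ε^ε / (1 + ε)^(1 + ε)` of `t (1 - t)^ε`, because `(1 - ε) 2^ε ≤ 1`. -/
lemma level_lt_max_of_critConst_lt (hε0 : 0 < ε) (hε1 : ε < 1) (hq : 0 < q) (hσ : σ ≠ 0)
    (hC : 0 < C) (h : critConst ε q σ < C) :
    (1 - ε) * q * σ ^ 2 / C ^ (1 + ε) < 1 / (1 + ε) * (1 - 1 / (1 + ε)) ^ ε := by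
  rw [← not_le, le_critConst_iff hε0 hq hσ hC, not_le] at h
  have hp : 0 < 1 + ε := by linarith
  have hmax : 1 / (1 + ε) * (1 - 1 / (1 + ε)) ^ ε = ε ^ ε / (1 + ε) ^ (1 + ε) := by
    rw [show 1 - 1 / (1 + ε) = ε / (1 + ε) by field_simp; ring,
      Real.div_rpow hε0.le hp.le, Real.rpow_add hp, Real.rpow_one]
    field_simp
  have h2 : (2 : ℝ) ^ ε ≤ 1 + ε := by
    have := rpow_one_add_le_one_add_mul_self (s := 1) (by norm_num) hε0.le hε1.le
    norm_num at this
    linarith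
  rw [hmax]
  calc (1 - ε) * q * σ ^ 2 / C ^ (1 + ε) = (1 - ε) * (q * σ ^ 2 / C ^ (1 + ε)) := by ring
    _ < (1 - ε) * ((2 * ε) ^ ε / (1 + ε) ^ (1 + ε)) := mul_lt_mul_of_pos_left h (by linarith)
    _ = ((1 - ε) * 2 ^ ε) * (ε ^ ε / (1 + ε) ^ (1 + ε)) := by
      rw [Real.mul_rpow (by norm_num) hε0.le]; ring
    _ ≤ 1 * (ε ^ ε / (1 + ε) ^ (1 + ε)) := by
      refine mul_le_mul_of_nonneg_right ?_ (by positivity)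
      nlinarith
    _ = _ := one_mul _

/-- The sign of `f'(t)` is that of `t (1 - t)^ε - (1 - ε) q σ² / C^(1 + ε)`, so `f` decreases up to
`t₁`, increases up to `t₂` and decreases again. Its minimum is thus at `t₁` or at `1`, and above the
critical constant `f(1)` is not minimal. -/
lemma exists_critRoots_eq_pair (hε0 : 0 < ε) (hε1 : ε < 1) (hq : 0 < q) (hσ : σ ≠ 0) (hC : 0 < C)
    (h : critConst ε q σ < C) :
    ∃ t₁ t₂ : ℝ, t₁ < t₂ ∧ critRoots ε q σ C = {t₁, t₂} ∧
      rate ε q σ C = costFun ε q σ C t₁ := by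
  have hlt := level_lt_max_of_critConst_lt hε0 hε1 hq hσ hC h
  have hrate := rate_lt_of_critConst_lt hε0 hε1 hq hσ hC h
  have hpos : 0 < (1 - ε) * q * σ ^ 2 / C ^ (1 + ε) := by
    have : 0 < 1 - ε := by linarith
    positivity
  have hder : ∀ t < 1, HasDerivAt (costFun ε q σ C) ((1 - t) ^ (-ε) / σ ^ 2 *
      (t * (1 - t) ^ ε - (1 - ε) * q * σ ^ 2 / C ^ (1 + ε))) t :=
    fun t ht => hasDerivAt_costFun hσ ht
  have hroots : critRoots ε q σ C = {t | t ∈ Set.Icc (0 : ℝ) 1 ∧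
    t * (1 - t) ^ ε = (1 - ε) * q * σ ^ 2 / C ^ (1 + ε)} := rfl
  set c := (1 - ε) * q * σ ^ 2 / C ^ (1 + ε) with hc
  set u := 1 / (1 + ε) with hu
  have hu0 : 0 < u := by positivity
  have hu1 : u < 1 := by rw [hu, div_lt_one (by linarith)]; linarith
  have hmono := strictMonoOn_mul_one_sub_rpow hε0
  have hanti := strictAntiOn_mul_one_sub_rpow hε0
  have hcont := continuous_mul_one_sub_rpow hε0
  rw [← hu] at hmono hanti
  obtain ⟨t₁, ⟨h10, h1u⟩, h1⟩ := intermediate_value_Ioo hu0.le hcont.continuousOn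
    (show c ∈ Set.Ioo _ _ by simpa using ⟨hpos, hlt⟩)
  obtain ⟨t₂, ⟨h2u, h21⟩, h2⟩ := intermediate_value_Ioo' hu1.le hcont.continuousOn
    (show c ∈ Set.Ioo _ _ by simpa [Real.zero_rpow hε0.ne'] using ⟨hpos, hlt⟩)
  simp only at h1 h2
  have hval : ∀ t ∈ Set.Icc (0 : ℝ) 1, (t < t₁ → t * (1 - t) ^ ε < c) ∧
      (t₁ < t → t < t₂ → c < t * (1 - t) ^ ε) ∧ (t₂ < t → t * (1 - t) ^ ε < c) := by
    rintro t ⟨ht0, ht1⟩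
    refine ⟨fun ht => ?_, fun ht ht' => ?_, fun ht => ?_⟩
    · rw [← h1]
      exact hmono ⟨ht0, by linarith⟩ ⟨h10.le, h1u.le⟩ ht
    · rcases le_total t u with htu | htu
      · rw [← h1]
        exact hmono ⟨h10.le, h1u.le⟩ ⟨ht0, htu⟩ ht
      · rw [← h2]
        exact hanti ⟨htu, ht1⟩ ⟨h2u.le, h21.le⟩ ht'
    · rw [← h2]
      exact hanti ⟨h2u.le, h21.le⟩ ⟨by linarith, ht1⟩ ht
  refine ⟨t₁, t₂, h1u.trans h2u, ?_, ?_⟩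
  · rw [hroots]
    ext t
    simp only [Set.mem_ofPred_eq, Set.mem_insert_iff, Set.mem_singleton_iff]
    constructor
    · rintro ⟨ht, hteq⟩
      obtain ⟨ha, hb, hd⟩ := hval t ht
      by_contra! hne
      rcases hne.1.lt_or_gt with h' | h'
      · exact (ha h').ne hteq
      rcases hne.2.lt_or_gt with h'' | h''
      · exact (hb h' h'').ne' hteq
      · exact (hd h'').ne hteq
    · rintro (rfl | rfl)
      · exact ⟨⟨h10.le, by linarith⟩, h1⟩
      · exact ⟨⟨by linarith, h21.le⟩, h2⟩
  · refine le_antisymm (rate_le_costFun hε1 ⟨h10.le, by linarith⟩) ?_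
    have hcf : Continuous (costFun ε q σ C) := continuous_costFun hε1
    have hwt : ∀ t < 1, 0 ≤ (1 - t) ^ (-ε) / σ ^ 2 := fun t ht =>
      div_nonneg (Real.rpow_nonneg (by linarith) _) (by positivity)
    have hA : AntitoneOn (costFun ε q σ C) (Set.Icc 0 t₁) := by
      refine antitoneOn_of_deriv_nonpos (convex_Icc _ _) hcf.continuousOn (fun t ht => ?_)
        fun t ht => ?_ <;> rw [interior_Icc] at ht
      · exact (hder t (by linarith [ht.2])).differentiableAt.differentiableWithinAt
      · rw [(hder t (by linarith [ht.2])).deriv]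
        exact mul_nonpos_of_nonneg_of_nonpos (hwt t (by linarith [ht.2]))
          (by linarith [(hval t ⟨ht.1.le, by linarith [ht.2]⟩).1 ht.2])
    have hB : MonotoneOn (costFun ε q σ C) (Set.Icc t₁ t₂) := by
      refine monotoneOn_of_deriv_nonneg (convex_Icc _ _) hcf.continuousOn (fun t ht => ?_)
        fun t ht => ?_ <;> rw [interior_Icc] at ht
      · exact (hder t (by linarith [ht.2])).differentiableAt.differentiableWithinAt
      · rw [(hder t (by linarith [ht.2])).deriv]
        exact mul_nonneg (hwt t (by linarith [ht.2]))
          (by linarith [(hval t ⟨by linarith [ht.1], by linarith [ht.2]⟩).2.1 ht.1 ht.2])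
    have hD : AntitoneOn (costFun ε q σ C) (Set.Icc t₂ 1) := by
      refine antitoneOn_of_deriv_nonpos (convex_Icc _ _) hcf.continuousOn (fun t ht => ?_)
        fun t ht => ?_ <;> rw [interior_Icc] at ht
      · exact (hder t (by linarith [ht.2])).differentiableAt.differentiableWithinAt
      · rw [(hder t (by linarith [ht.2])).deriv]
        exact mul_nonpos_of_nonneg_of_nonpos (hwt t (by linarith [ht.2]))
          (by linarith [(hval t ⟨by linarith [ht.1], by linarith [ht.2]⟩).2.2 ht.1])
    obtain ⟨t, ⟨ht0, ht1⟩, ht⟩ := exists_costFun_eq_rate (q := q) (σ := σ) (C := C) hε1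
    rw [← ht]
    rcases le_total t t₁ with h' | h'
    · exact hA ⟨ht0, h'⟩ ⟨h10.le, le_rfl⟩ h'
    rcases le_total t t₂ with h'' | h''
    · exact hB ⟨le_rfl, by linarith⟩ ⟨h', h''⟩ h'
    · have := hD ⟨h'', ht1⟩ ⟨h21.le, le_rfl⟩ ht1
      linarith

end Variational

/-! ### Scales -/

/-- The speed `x_n² / n` of the large deviation principle. -/
noncomputable def speed (ε C : ℝ) (n : ℕ) : ℝ := level ε C n ^ 2 / n

section Scales

variable {ε C : ℝ}

lemma level_pos (hC : 0 < C) {n : ℕ} (hn : 0 < n) : 0 < level ε C n := by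
  have : (0 : ℝ) < n := by exact_mod_cast hn
  unfold level; positivity

lemma speed_pos (hC : 0 < C) {n : ℕ} (hn : 0 < n) : 0 < speed ε C n := by
  have : (0 : ℝ) < n := by exact_mod_cast hn
  have := level_pos (ε := ε) hC hn
  unfold speed; positivity

lemma speed_eq (hε0 : 0 < ε) {n : ℕ} (hn : 0 < n) :
    speed ε C n = C ^ 2 * (n : ℝ) ^ ((1 - ε) / (1 + ε)) := by
  have h : (0 : ℝ) < n := by exact_mod_cast hn
  have hp : 1 + ε ≠ 0 := by linarith
  have h1 : (n : ℝ) ^ ((1 - ε) / (1 + ε)) * n = ((n : ℝ) ^ (1 / (1 + ε))) ^ 2 := by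
    rw [← Real.rpow_natCast, ← Real.rpow_mul h.le]
    nth_rw 2 [← Real.rpow_one (n : ℝ)]
    rw [← Real.rpow_add h]
    congr 1
    push_cast
    field_simp
    ring
  rw [speed, level, div_eq_iff h.ne', mul_assoc, h1, mul_pow]

lemma level_div_eq (hε0 : 0 < ε) {n : ℕ} (hn : 0 < n) :
    level ε C n / n = C * (n : ℝ) ^ (-(ε / (1 + ε))) := by
  have h : (0 : ℝ) < n := by exact_mod_cast hn
  have hp : 1 + ε ≠ 0 := by linarith
  have h1 : (n : ℝ) ^ (-(ε / (1 + ε))) * n = (n : ℝ) ^ (1 / (1 + ε)) := by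
    nth_rw 2 [← Real.rpow_one (n : ℝ)]
    rw [← Real.rpow_add h]
    congr 1
    field_simp
    ring
  rw [level, div_eq_iff h.ne', mul_assoc, h1]

lemma level_rpow_one_add (hε0 : 0 < ε) (hC : 0 < C) (n : ℕ) :
    level ε C n ^ (1 + ε) = C ^ (1 + ε) * n := by
  rw [level, Real.mul_rpow hC.le (by positivity), ← Real.rpow_mul (by positivity),
    one_div_mul_cancel (by linarith), Real.rpow_one]

lemma level_rpow_one_sub (hε0 : 0 < ε) (hC : 0 < C) {n : ℕ} (hn : 0 < n) :
    level ε C n ^ (1 - ε) = speed ε C n / C ^ (1 + ε) := by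
  have h : (0 : ℝ) < n := by exact_mod_cast hn
  have hl := level_pos (ε := ε) hC hn
  have h2 : level ε C n ^ (1 - ε) = level ε C n ^ 2 / level ε C n ^ (1 + ε) := by
    rw [← Real.rpow_natCast, ← Real.rpow_sub hl]
    congr 1
    push_cast
    ring
  rw [h2, level_rpow_one_add hε0 hC, speed, div_div, mul_comm]

lemma tendsto_level (hε0 : 0 < ε) (hC : 0 < C) : Tendsto (level ε C) atTop atTop :=
  ((tendsto_rpow_atTop (by positivity)).comp tendsto_natCast_atTop_atTop).const_mul_atTop hC

lemma tendsto_speed (hε0 : 0 < ε) (hε1 : ε < 1) (hC : 0 < C) :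
    Tendsto (speed ε C) atTop atTop := by
  have hp : 0 < (1 - ε) / (1 + ε) := div_pos (by linarith) (by linarith)
  refine Tendsto.congr' ?_ (((tendsto_rpow_atTop hp).comp
    tendsto_natCast_atTop_atTop).const_mul_atTop (show 0 < C ^ 2 by positivity))
  filter_upwards [eventually_gt_atTop 0] with n hn
  rw [speed_eq hε0 hn]; rfl

lemma tendsto_level_div (hε0 : 0 < ε) :
    Tendsto (fun n : ℕ => level ε C n / n) atTop (𝓝 0) := by
  have hp : 0 < ε / (1 + ε) := by positivity
  have := ((tendsto_rpow_neg_atTop hp).comp tendsto_natCast_atTop_atTop).const_mul C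
  rw [mul_zero] at this
  refine this.congr' ?_
  filter_upwards [eventually_gt_atTop 0] with n hn
  rw [level_div_eq hε0 hn]; rfl

lemma tendsto_speed_div (hε0 : 0 < ε) :
    Tendsto (fun n : ℕ => speed ε C n / n) atTop (𝓝 0) := by
  have := (tendsto_level_div (C := C) hε0).pow 2
  rw [zero_pow (by norm_num)] at this
  refine this.congr fun n => ?_
  rw [speed, div_pow]; ring

end Scales

/-! ### Two-sided exponential bounds for the tail of one summand -/

section Tail

variable {ε q q' : ℝ} {F : ℝ → ℝ}

lemma eventually_exp_le_of_log_isEquivalent (hF : ∀ x, 0 ≤ F x) (hq : 0 < q)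
    (h : (fun x : ℝ => Real.log (F x)) ~[atTop] (fun x : ℝ => -q * x ^ (1 - ε))) (hq' : q < q') :
    ∀ᶠ x in atTop, Real.exp (-q' * x ^ (1 - ε)) ≤ F x := by
  obtain ⟨φ, hφ, hφe⟩ := h.exists_eq_mul
  have h1 : ∀ᶠ x in atTop, φ x * q < q' := by
    refine (hφ.mul_const q).eventually (gt_mem_nhds (by simpa using hq'))
  filter_upwards [h1, hφe, hφ.eventually (lt_mem_nhds zero_lt_one),
    eventually_gt_atTop (0 : ℝ)] with x h1 h2 h3 hx
  simp only [Pi.mul_apply] at h2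
  have hp : 0 < x ^ (1 - ε) := Real.rpow_pos_of_pos hx _
  -- `F x = 0` is excluded because then `Real.log (F x) = 0`.
  have hne : F x ≠ 0 := by
    intro h0
    rw [h0, Real.log_zero] at h2
    have : 0 < φ x * (q * x ^ (1 - ε)) := by positivity
    nlinarith
  rw [← Real.le_log_iff_exp_le ((hF x).lt_of_ne' hne), h2]
  nlinarith

lemma eventually_le_exp_of_log_isEquivalent (hF : ∀ x, 0 ≤ F x)
    (h : (fun x : ℝ => Real.log (F x)) ~[atTop] (fun x : ℝ => -q * x ^ (1 - ε))) (hq' : q' < q) :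
    ∀ᶠ x in atTop, F x ≤ Real.exp (-q' * x ^ (1 - ε)) := by
  obtain ⟨φ, hφ, hφe⟩ := h.exists_eq_mul
  have h1 : ∀ᶠ x in atTop, q' < φ x * q := by
    refine (hφ.mul_const q).eventually (lt_mem_nhds (by simpa using hq'))
  filter_upwards [h1, hφe, eventually_gt_atTop (0 : ℝ)] with x h1 h2 hx
  simp only [Pi.mul_apply] at h2
  have hp : 0 < x ^ (1 - ε) := Real.rpow_pos_of_pos hx _
  rcases (hF x).eq_or_lt with h0 | h0
  · rw [← h0]; positivity
  rw [← Real.log_le_iff_le_exp h0, h2]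
  nlinarith

end Tail

/-! ### The tail of the partial sums is supermultiplicative -/

/-- The upper tail `P(S_n ≥ x)` of the partial sums of `Y`. -/
noncomputable def sumTail {Ω : Type*} [MeasurableSpace Ω] (P : Measure Ω) (Y : ℕ → Ω → ℝ)
    (n : ℕ) (x : ℝ) : ℝ :=
  P.real {ω | x ≤ ∑ i ∈ Finset.range n, Y i ω}

section SumTail

variable {Ω : Type*} [MeasurableSpace Ω] {P : Measure Ω} {Y : ℕ → Ω → ℝ}

lemma sumTail_nonneg (n : ℕ) (x : ℝ) : 0 ≤ sumTail P Y n x := measureReal_nonneg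

lemma sumTail_one (x : ℝ) : sumTail P Y 1 x = P.real {ω | x ≤ Y 0 ω} := by simp [sumTail]

variable [IsProbabilityMeasure P]

lemma sumTail_anti (n : ℕ) {x y : ℝ} (h : x ≤ y) : sumTail P Y n y ≤ sumTail P Y n x :=
  measureReal_mono fun _ hω => h.trans hω

/-- The first `a` summands contribute `x`, and the next `b`, an independent copy, contribute `y`. -/
lemma sumTail_mul_le (hindep : iIndepFun Y P) (hident : ∀ i, IdentDistrib (Y i) (Y 0) P P)
    (a b : ℕ) (x y : ℝ) :
    sumTail P Y a x * sumTail P Y b y ≤ sumTail P Y (a + b) (x + y) := by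
  have hm i := (hident i).aemeasurable_fst
  have hshift : IdentDistrib (fun ω i => Y (a + i) ω) (fun ω i => Y i ω) P P :=
    IdentDistrib.pi (fun i => (hident (a + i)).trans (hident i).symm)
      (hindep.precomp (add_right_injective a)) hindep
  have hsum : IdentDistrib (fun ω => ∑ i ∈ Finset.range b, Y (a + i) ω)
      (fun ω => ∑ i ∈ Finset.range b, Y i ω) P P :=
    hshift.comp (u := fun z : ℕ → ℝ => ∑ i ∈ Finset.range b, z i) (by fun_prop)
  have hdisj : Disjoint (Finset.range a) (Finset.Ico a (a + b)) := by
    rw [Finset.range_eq_Ico]; exact Finset.Ico_disjoint_Ico_consecutive 0 a (a + b)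
  have hind := (hindep.indepFun_finset₀ _ _ hdisj hm).comp
    (φ := fun z => ∑ i, z i) (ψ := fun z => ∑ i, z i)
    (by fun_prop) (by fun_prop)
  have hmul := hind.measure_inter_preimage_eq_mul (Set.Ici x) (Set.Ici y)
    measurableSet_Ici measurableSet_Ici
  have e1 : (fun z : Finset.range a → ℝ => ∑ i, z i) ∘ (fun ω (i : Finset.range a) => Y i ω)
      = fun ω => ∑ i ∈ Finset.range a, Y i ω := by
    ext ω
    exact Finset.sum_coe_sort (Finset.range a) fun i => Y i ω
  have e2 : (fun z : Finset.Ico a (a + b) → ℝ => ∑ i, z i) ∘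
      (fun ω (i : Finset.Ico a (a + b)) => Y i ω)
      = fun ω => ∑ i ∈ Finset.range b, Y (a + i) ω := by
    ext ω
    refine (Finset.sum_coe_sort (Finset.Ico a (a + b)) fun i => Y i ω).trans ?_
    rw [Finset.sum_Ico_eq_sum_range]
    simp
  rw [e1, e2] at hmul
  have hb : P ((fun ω => ∑ i ∈ Finset.range b, Y (a + i) ω) ⁻¹' Set.Ici y) =
      P {ω | y ≤ ∑ i ∈ Finset.range b, Y i ω} := hsum.measure_mem_eq measurableSet_Ici
  rw [hb] at hmul
  have : sumTail P Y a x * sumTail P Y b y = P.real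
      ((fun ω => ∑ i ∈ Finset.range a, Y i ω) ⁻¹' Set.Ici x ∩
        (fun ω => ∑ i ∈ Finset.range b, Y (a + i) ω) ⁻¹' Set.Ici y) := by
    rw [measureReal_def, hmul, ENNReal.toReal_mul]; rfl
  rw [this]
  refine measureReal_mono fun ω hω => ?_
  change x + y ≤ ∑ i ∈ Finset.range (a + b), Y i ω
  rw [Finset.sum_range_add]
  exact add_le_add hω.1 hω.2

lemma sumTail_pow_le (hindep : iIndepFun Y P) (hident : ∀ i, IdentDistrib (Y i) (Y 0) P P)
    (k m : ℕ) (x : ℝ) : sumTail P Y m x ^ k ≤ sumTail P Y (k * m) (k * x) := by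
  induction k with
  | zero => simp [sumTail]
  | succ k ih =>
    calc sumTail P Y m x ^ (k + 1) = sumTail P Y m x ^ k * sumTail P Y m x := pow_succ _ _
      _ ≤ sumTail P Y (k * m) (k * x) * sumTail P Y m x :=
        mul_le_mul_of_nonneg_right ih (sumTail_nonneg _ _)
      _ ≤ sumTail P Y (k * m + m) (k * x + x) := sumTail_mul_le hindep hident _ _ _ _
      _ = _ := by push_cast; congr 1 <;> ring

/-- Chebyshev's inequality: a sum of `r ≪ y²` terms is at least `-y` with probability at least one
half. -/
lemma half_le_sumTail_neg (hindep : iIndepFun Y P) (hident : ∀ i, IdentDistrib (Y i) (Y 0) P P)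
    (hL2 : MemLp (Y 0) 2 P) (h0 : ∫ ω, Y 0 ω ∂P = 0) {r : ℕ} {y : ℝ} (hy : 0 < y)
    (h : r * variance (Y 0) P / y ^ 2 ≤ 1 / 2) : 1 / 2 ≤ sumTail P Y r (-y) := by
  have hL i : MemLp (Y i) 2 P := (hident i).memLp_iff.2 hL2
  have hsumL : MemLp (fun ω => ∑ i ∈ Finset.range r, Y i ω) 2 P :=
    memLp_finsetSum _ fun i _ => hL i
  have hmean : ∫ ω, ∑ i ∈ Finset.range r, Y i ω ∂P = 0 := by
    rw [integral_finsetSum _ fun i _ => (hL i).integrable (by norm_num)]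
    exact Finset.sum_eq_zero fun i _ => by rw [(hident i).integral_eq, h0]
  have hvar : variance (fun ω => ∑ i ∈ Finset.range r, Y i ω) P = r * variance (Y 0) P := by
    have := IndepFun.variance_sum (s := Finset.range r) (fun i _ => hL i)
      (fun i _ j _ hij => hindep.indepFun hij)
    rw [show (fun ω => ∑ i ∈ Finset.range r, Y i ω) = ∑ i ∈ Finset.range r, Y i by
      ext; simp, this]
    simp [fun i => (hident i).variance_eq]
  have hch := meas_ge_le_variance_div_sq hsumL hy
  rw [hmean, hvar] at hch
  simp only [sub_zero] at hch
  have hch' : P.real {ω | y ≤ |∑ i ∈ Finset.range r, Y i ω|} ≤ 1 / 2 := by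
    refine (ENNReal.toReal_mono ENNReal.ofReal_ne_top hch).trans ?_
    rw [ENNReal.toReal_ofReal (by have := variance_nonneg (Y 0) P; positivity)]
    exact h
  have hun : 1 ≤ sumTail P Y r (-y) + P.real {ω | y ≤ |∑ i ∈ Finset.range r, Y i ω|} := by
    refine le_trans ?_ (measureReal_union_le _ _)
    rw [← probReal_univ (μ := P)]
    refine measureReal_mono fun ω _ => ?_
    rcases le_or_gt y |∑ i ∈ Finset.range r, Y i ω| with h' | h'
    · exact Or.inr h'
    · exact Or.inl (abs_lt.1 h').1.le
  linarith

end SumTail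

/-! ### The lower bound -/

section LowerBound

variable {Ω : Type*} [MeasurableSpace Ω] {P : Measure Ω} [IsProbabilityMeasure P]
  {Y : ℕ → Ω → ℝ} {ε q σ C : ℝ}

lemma gaussianPDFReal_le_measure_Ioi {v : NNReal} (hv : v ≠ 0) {a : ℝ} (ha : 0 ≤ a) :
    ENNReal.ofReal (gaussianPDFReal 0 v (a + 1)) ≤ gaussianReal 0 v (Set.Ioi a) := by
  have h1 : ENNReal.ofReal (gaussianPDFReal 0 v (a + 1)) =
      ∫⁻ _ in Set.Ioc a (a + 1), ENNReal.ofReal (gaussianPDFReal 0 v (a + 1)) := by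
    simp
  refine le_trans ?_ (measure_mono (Set.Ioc_subset_Ioi_self (a := a + 1) (b := a)))
  rw [gaussianReal_apply _ hv, h1]
  refine setLIntegral_mono' measurableSet_Ioc fun x hx => ENNReal.ofReal_le_ofReal ?_
  unfold gaussianPDFReal
  have h2 : x ^ 2 ≤ (a + 1) ^ 2 := pow_le_pow_left₀ (by linarith [hx.1]) hx.2 2
  simp only [sub_zero]
  gcongr

/-- By the central limit theorem, `P(S_m ≥ a √m)` is eventually bounded below by a constant whose
logarithm is `-a² / (2 σ²)` to leading order as `a → ∞`. -/
lemma eventually_le_sumTail_mul_sqrt (hindep : iIndepFun Y P)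
    (hident : ∀ i, IdentDistrib (Y i) (Y 0) P P) (hL2 : MemLp (Y 0) 2 P)
    (h0 : ∫ ω, Y 0 ω ∂P = 0) (hvar : variance (Y 0) P = σ ^ 2) (hσ : σ ≠ 0) {a : ℝ}
    (ha : 0 ≤ a) :
    ∀ᶠ m : ℕ in atTop, (√(2 * Real.pi * σ ^ 2))⁻¹ * Real.exp (-(a + 1) ^ 2 / (2 * σ ^ 2)) / 2 ≤
      sumTail P Y m (a * √m) := by
  have hv : (variance (Y 0) P).toNNReal ≠ 0 := by
    rw [hvar]; simpa using hσ
  have hcoe : ((variance (Y 0) P).toNNReal : ℝ) = σ ^ 2 := by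
    rw [hvar, Real.coe_toNNReal _ (sq_nonneg σ)]
  have hpdf : gaussianPDFReal 0 (variance (Y 0) P).toNNReal (a + 1) =
      (√(2 * Real.pi * σ ^ 2))⁻¹ * Real.exp (-(a + 1) ^ 2 / (2 * σ ^ 2)) := by
    rw [gaussianPDFReal, hcoe, sub_zero]
  have hclt := tendstoInDistribution_inv_sqrt_mul_sum_sub
    (HasLaw.id (μ := gaussianReal 0 (variance (Y 0) P).toNNReal)) hL2 hindep hident
  have hlim := ProbabilityMeasure.le_liminf_measure_open_of_tendsto hclt.tendsto
    (isOpen_Ioi (a := a))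
  have hlow := gaussianPDFReal_le_measure_Ioi hv ha
  rw [hpdf] at hlow
  have hpos : 0 < (√(2 * Real.pi * σ ^ 2))⁻¹ * Real.exp (-(a + 1) ^ 2 / (2 * σ ^ 2)) := by
    have := Real.pi_pos
    positivity
  have hlt := (((ENNReal.ofReal_lt_ofReal_iff hpos).2 (half_lt_self hpos)).trans_le hlow).trans_le
    (by simpa using hlim)
  filter_upwards [eventually_lt_of_lt_liminf hlt, eventually_gt_atTop 0] with m hm hm0
  have hm0' : 0 < √(m : ℝ) := Real.sqrt_pos.2 (by exact_mod_cast hm0)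
  rw [Measure.map_apply_of_aemeasurable (hclt.forall_aemeasurable m) measurableSet_Ioi] at hm
  have := (ENNReal.ofReal_le_iff_le_toReal (measure_ne_top _ _)).1 hm.le
  refine this.trans (measureReal_mono fun ω hω => ?_)
  simp only [h0, mul_zero, sub_zero, Set.mem_preimage, Set.mem_Ioi] at hω
  rw [inv_mul_eq_div, lt_div_iff₀ hm0'] at hω
  exact hω.le

/-- As the threshold `a` grows, the cost per block in the Gaussian lower bound, multiplied by the
number `w² / a²` of blocks, approaches the Gaussian rate `w² / (2 σ²)`. -/
lemma exists_mul_log_gaussian_lt (hσ : σ ≠ 0) {w v : ℝ} (hv : w ^ 2 / (2 * σ ^ 2) < v) :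
    ∃ a > 0, w ^ 2 / a ^ 2 * -Real.log
      ((√(2 * Real.pi * σ ^ 2))⁻¹ * Real.exp (-(a + 1) ^ 2 / (2 * σ ^ 2)) / 2) < v := by
  have hD : 0 < (√(2 * Real.pi * σ ^ 2))⁻¹ := by
    have := Real.pi_pos
    positivity
  set D := (√(2 * Real.pi * σ ^ 2))⁻¹
  have hlim : Tendsto (fun a : ℝ => w ^ 2 * ((1 + a⁻¹) ^ 2 / (2 * σ ^ 2) +
      (Real.log 2 - Real.log D) * a⁻¹ ^ 2)) atTop
      (𝓝 (w ^ 2 * ((1 + 0) ^ 2 / (2 * σ ^ 2) + (Real.log 2 - Real.log D) * 0 ^ 2))) := by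
    have h := tendsto_inv_atTop_zero (𝕜 := ℝ)
    exact ((((h.const_add 1).pow 2).div_const _).add ((h.pow 2).const_mul _)).const_mul _
  have hlt : w ^ 2 * ((1 + 0) ^ 2 / (2 * σ ^ 2) + (Real.log 2 - Real.log D) * 0 ^ 2) < v := by
    refine lt_of_eq_of_lt ?_ hv
    ring
  obtain ⟨a, ha, ha0⟩ := ((hlim.eventually (gt_mem_nhds hlt)).and (eventually_gt_atTop 0)).exists
  refine ⟨a, ha0, lt_of_eq_of_lt ?_ ha⟩
  rw [Real.log_div (by positivity) (by norm_num), Real.log_mul hD.ne' (by positivity),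
    Real.log_exp]
  field_simp
  ring

/-- The moderate deviation lower bound. The sum is cut into `k ≍ x_n² / n` blocks, each of which
deviates by a large constant multiple `a` of its standard deviation. -/
lemma exists_blocks_exp_le_sumTail (hindep : iIndepFun Y P)
    (hident : ∀ i, IdentDistrib (Y i) (Y 0) P P) (hL2 : MemLp (Y 0) 2 P)
    (h0 : ∫ ω, Y 0 ω ∂P = 0) (hvar : variance (Y 0) P = σ ^ 2) (hσ : σ ≠ 0)
    (hε0 : 0 < ε) (hε1 : ε < 1) (hC : 0 < C) {s v : ℝ} (hs : 0 ≤ s) (hv : s ^ 2 / (2 * σ ^ 2) < v) :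
    ∃ δ > 0, ∀ᶠ n : ℕ in atTop, ∃ N : ℕ, N + 1 ≤ n ∧
      Real.exp (-v * speed ε C n) ≤ sumTail P Y N ((s + δ) * level ε C n) := by
  have hw : ∃ w > s, w ^ 2 / (2 * σ ^ 2) < v := by
    have hc : Continuous fun w : ℝ => w ^ 2 / (2 * σ ^ 2) := by fun_prop
    have h1 := (hc.continuousAt (x := s)).eventually (gt_mem_nhds hv)
    obtain ⟨w, hw, hws⟩ :=
      ((h1.filter_mono nhdsWithin_le_nhds).and (self_mem_nhdsWithin (s := Set.Ioi s))).exists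
    exact ⟨w, hws, hw⟩
  obtain ⟨w, hsw, hw⟩ := hw
  obtain ⟨a, ha, hav⟩ := exists_mul_log_gaussian_lt hσ hw
  have hG := eventually_le_sumTail_mul_sqrt hindep hident hL2 h0 hvar hσ ha.le
  have hGpos : 0 < (√(2 * Real.pi * σ ^ 2))⁻¹ * Real.exp (-(a + 1) ^ 2 / (2 * σ ^ 2)) / 2 := by
    have := Real.pi_pos
    positivity
  set G := (√(2 * Real.pi * σ ^ 2))⁻¹ * Real.exp (-(a + 1) ^ 2 / (2 * σ ^ 2)) / 2
  have hw0 : 0 < w := by linarith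
  set b := w ^ 2 / a ^ 2 with hb
  have hb0 : 0 < b := by positivity
  refine ⟨(w - s) / 2, by linarith, ?_⟩
  set k : ℕ → ℕ := fun n => ⌈b * speed ε C n⌉₊ with hk
  set m : ℕ → ℕ := fun n => (n - 1) / k n with hm
  have hkL : Tendsto (fun n => (k n : ℝ) / speed ε C n) atTop (𝓝 b) :=
    (tendsto_nat_ceil_mul_div_atTop hb0.le).comp (tendsto_speed hε0 hε1 hC)
  have hkpos : ∀ᶠ n in atTop, 0 < k n := by
    filter_upwards [eventually_gt_atTop 0] with n hn
    exact Nat.ceil_pos.2 (mul_pos hb0 (speed_pos hC hn))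
  have hkn : Tendsto (fun n : ℕ => (k n : ℝ) / n) atTop (𝓝 0) := by
    have := hkL.mul (tendsto_speed_div (C := C) hε0)
    rw [mul_zero] at this
    refine this.congr' ?_
    filter_upwards [eventually_gt_atTop 0] with n hn
    have := speed_pos (ε := ε) hC hn
    field_simp
  have hmtop : Tendsto m atTop atTop := by
    refine tendsto_atTop.2 fun M => ?_
    filter_upwards [hkn.eventually (gt_mem_nhds (show (0 : ℝ) < 1 / (M + 1) by positivity)),
      hkpos, eventually_gt_atTop 0] with n h1 h2 h3
    rw [div_lt_div_iff₀ (by exact_mod_cast h3) (by positivity)] at h1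
    have h4 : k n * (M + 1) < n := by
      have : ((k n * (M + 1) : ℕ) : ℝ) < n := by push_cast; linarith
      exact_mod_cast this
    rw [hm, Nat.le_div_iff_mul_le h2]
    have : k n * (M + 1) = M * k n + k n := by ring
    omega
  -- The threshold `(s + δ) x_n` is at most `k` times the block threshold `a √m`.
  have hratio : ∀ᶠ n : ℕ in atTop,
      (s + (w - s) / 2) ^ 2 < a ^ 2 * (k n / speed ε C n * (1 - k n / n)) := by
    have h1 : Tendsto (fun n : ℕ => a ^ 2 * (k n / speed ε C n * (1 - k n / n))) atTop
        (𝓝 (a ^ 2 * (b * (1 - 0)))) := (hkL.mul (hkn.const_sub 1)).const_mul _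
    refine h1.eventually (lt_mem_nhds ?_)
    have : a ^ 2 * (b * (1 - 0)) = w ^ 2 := by rw [hb]; field_simp; ring
    rw [this]
    exact pow_lt_pow_left₀ (by linarith) (by linarith) (by norm_num)
  have hcost : ∀ᶠ n : ℕ in atTop, k n / speed ε C n * -Real.log G < v :=
    (hkL.mul_const _).eventually (gt_mem_nhds hav)
  filter_upwards [hratio, hcost, hkpos, hmtop.eventually hG, eventually_gt_atTop 0]
    with n h1 h2 h3 h4 hn
  have hn' : (0 : ℝ) < n := by exact_mod_cast hn
  have hL := speed_pos (ε := ε) hC hn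
  have hx := level_pos (ε := ε) hC hn
  refine ⟨k n * m n, ?_, ?_⟩
  · have : k n * m n ≤ n - 1 := Nat.mul_div_le _ _
    omega
  have hkm : (n : ℝ) - k n ≤ k n * m n := by
    have : n - 1 < k n * m n + k n := by
      have := Nat.lt_mul_div_succ (n - 1) h3
      rwa [mul_add, mul_one] at this
    have : n ≤ k n * m n + k n := by omega
    have : (n : ℝ) ≤ k n * m n + k n := by exact_mod_cast this
    linarith
  have hthr : (s + (w - s) / 2) * level ε C n ≤ k n * (a * √(m n)) := by
    refine le_of_sq_le_sq ?_ (by positivity)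
    rw [mul_pow, mul_pow, mul_pow, Real.sq_sqrt (by positivity)]
    have hxL : level ε C n ^ 2 = speed ε C n * n := by
      rw [speed]; field_simp
    calc (s + (w - s) / 2) ^ 2 * level ε C n ^ 2
        ≤ a ^ 2 * (k n / speed ε C n * (1 - k n / n)) * level ε C n ^ 2 :=
          mul_le_mul_of_nonneg_right h1.le (by positivity)
      _ = a ^ 2 * k n * (n - k n) := by rw [hxL]; field_simp
      _ ≤ a ^ 2 * k n * (k n * m n) := mul_le_mul_of_nonneg_left hkm (by positivity)
      _ = _ := by ring
  calc Real.exp (-v * speed ε C n) ≤ Real.exp (k n * Real.log G) := by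
        rw [Real.exp_le_exp]
        rw [div_mul_eq_mul_div, div_lt_iff₀ hL] at h2
        linarith
    _ = G ^ k n := by rw [Real.exp_nat_mul, Real.exp_log hGpos]
    _ ≤ sumTail P Y (m n) (a * √(m n)) ^ k n := pow_le_pow_left₀ hGpos.le h4 _
    _ ≤ sumTail P Y (k n * m n) (k n * (a * √(m n))) := sumTail_pow_le hindep hident _ _ _
    _ ≤ _ := sumTail_anti _ hthr

/-- The cost `f(t)` is achieved by letting one summand contribute `(1 - t) x_n` and the others
`t x_n` by a moderate deviation. -/
lemma eventually_exp_le_sumTail_of_costFun_lt (hindep : iIndepFun Y P)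
    (hident : ∀ i, IdentDistrib (Y i) (Y 0) P P) (hL2 : MemLp (Y 0) 2 P)
    (h0 : ∫ ω, Y 0 ω ∂P = 0) (hvar : variance (Y 0) P = σ ^ 2) (hσ : σ ≠ 0)
    (hε0 : 0 < ε) (hε1 : ε < 1) (hq : 0 < q) (hC : 0 < C)
    (htail : (fun x : ℝ => Real.log (P.real {ω | x ≤ Y 0 ω}))
      ~[atTop] (fun x : ℝ => -q * x ^ (1 - ε)))
    {t c : ℝ} (ht0 : 0 ≤ t) (ht1 : t < 1) (hc : costFun ε q σ C t < c) :
    ∀ᶠ n : ℕ in atTop, Real.exp (-c * speed ε C n) ≤ sumTail P Y n (level ε C n) := by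
  obtain ⟨κ, hκ, hκc⟩ : ∃ κ > 0, costFun ε q σ C t + 3 * κ = c :=
    ⟨(c - costFun ε q σ C t) / 3, by linarith, by ring⟩
  have hCp : 0 < C ^ (1 + ε) := Real.rpow_pos_of_pos hC _
  obtain ⟨δ, hδ, hmid⟩ := exists_blocks_exp_le_sumTail hindep hident hL2 h0 hvar hσ hε0 hε1 hC
    ht0 (v := t ^ 2 / (2 * σ ^ 2) + κ) (by linarith)
  have hjump := eventually_exp_le_of_log_isEquivalent (fun _ => measureReal_nonneg) hq htail
    (q' := q + κ * C ^ (1 + ε)) (by nlinarith)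
  have hjump' := ((tendsto_level (C := C) hε0 hC).const_mul_atTop
    (show 0 < 1 - t by linarith)).eventually hjump
  have hrest : ∀ᶠ n : ℕ in atTop, 2 * σ ^ 2 / δ ^ 2 ≤ speed ε C n :=
    (tendsto_speed hε0 hε1 hC).eventually_ge_atTop _
  have hlog : ∀ᶠ n : ℕ in atTop, Real.log 2 / κ ≤ speed ε C n :=
    (tendsto_speed hε0 hε1 hC).eventually_ge_atTop _
  filter_upwards [hmid, hjump', hrest, hlog, eventually_gt_atTop 0] with n h1 h2 h3 h4 hn
  obtain ⟨N, hN, h1⟩ := h1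
  have hn' : (0 : ℝ) < n := by exact_mod_cast hn
  have hL := speed_pos (ε := ε) hC hn
  have hx := level_pos (ε := ε) hC hn
  -- One big jump, `N` summands in blocks, and `r` leftover summands, which cost a factor `1 / 2`.
  obtain ⟨r, rfl⟩ := Nat.exists_eq_add_of_le' hN
  have hrn : (r : ℝ) ≤ ((r + (N + 1) : ℕ) : ℝ) := by exact_mod_cast Nat.le_add_right _ _
  set n := r + (N + 1) with hndef
  have hhalf : 1 / 2 ≤ sumTail P Y r (-(δ * level ε C n)) := by
    refine half_le_sumTail_neg hindep hident hL2 h0 (by positivity) ?_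
    rw [hvar, mul_pow, div_le_iff₀ (by positivity)]
    rw [div_le_iff₀ (by positivity), speed, div_mul_eq_mul_div, le_div_iff₀ hn'] at h3
    have : r * σ ^ 2 ≤ n * σ ^ 2 := mul_le_mul_of_nonneg_right hrn (sq_nonneg _)
    nlinarith
  have hexp : Real.exp (-κ * speed ε C n) ≤ sumTail P Y r (-(δ * level ε C n)) := by
    refine le_trans ?_ hhalf
    rw [div_le_iff₀ hκ] at h4
    rw [one_div, ← Real.exp_log (show (0 : ℝ) < 2⁻¹ by norm_num), Real.exp_le_exp, Real.log_inv]
    linarith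
  have hbig : Real.exp (-(q * (1 - t) ^ (1 - ε) / C ^ (1 + ε) + κ) * speed ε C n) ≤
      sumTail P Y 1 ((1 - t) * level ε C n) := by
    rw [sumTail_one]
    refine le_trans ?_ h2
    rw [Real.exp_le_exp, Real.mul_rpow (by linarith) hx.le, level_rpow_one_sub hε0 hC hn]
    have hp1 : (1 - t) ^ (1 - ε) ≤ 1 :=
      Real.rpow_le_one (by linarith) (by linarith) (by linarith)
    have e : -(q + κ * C ^ (1 + ε)) * ((1 - t) ^ (1 - ε) * (speed ε C n / C ^ (1 + ε))) =
      -(q * (1 - t) ^ (1 - ε) / C ^ (1 + ε) + κ * (1 - t) ^ (1 - ε)) * speed ε C n := by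
      field_simp
    rw [e]
    have := mul_le_mul_of_nonneg_left hp1 (mul_pos hκ hL).le
    linarith
  have hsplit : Real.exp (-c * speed ε C n) =
      Real.exp (-κ * speed ε C n) * (Real.exp (-(t ^ 2 / (2 * σ ^ 2) + κ) * speed ε C n) *
        Real.exp (-(q * (1 - t) ^ (1 - ε) / C ^ (1 + ε) + κ) * speed ε C n)) := by
    rw [← Real.exp_add, ← Real.exp_add, ← hκc, costFun]
    congr 1
    ring
  have hlev : level ε C n = -(δ * level ε C n) +
      ((t + δ) * level ε C n + (1 - t) * level ε C n) := by ring
  rw [hsplit, hlev, hndef]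
  refine le_trans ?_ (sumTail_mul_le hindep hident _ _ _ _)
  refine mul_le_mul hexp ?_ (by positivity) (sumTail_nonneg _ _)
  refine le_trans ?_ (sumTail_mul_le hindep hident _ _ _ _)
  exact mul_le_mul h1 hbig (by positivity) (sumTail_nonneg _ _)

lemma eventually_exp_le_sumTail (hindep : iIndepFun Y P)
    (hident : ∀ i, IdentDistrib (Y i) (Y 0) P P) (hL2 : MemLp (Y 0) 2 P)
    (h0 : ∫ ω, Y 0 ω ∂P = 0) (hvar : variance (Y 0) P = σ ^ 2) (hσ : σ ≠ 0)
    (hε0 : 0 < ε) (hε1 : ε < 1) (hq : 0 < q) (hC : 0 < C)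
    (htail : (fun x : ℝ => Real.log (P.real {ω | x ≤ Y 0 ω}))
      ~[atTop] (fun x : ℝ => -q * x ^ (1 - ε)))
    {c : ℝ} (hc : rate ε q σ C < c) :
    ∀ᶠ n : ℕ in atTop, Real.exp (-c * speed ε C n) ≤ sumTail P Y n (level ε C n) := by
  -- For `t = 1` no summand is large, so the tail asymptotics say nothing; move `t` below `1`.
  obtain ⟨t, ht, hct⟩ : ∃ t ∈ Set.Ico (0 : ℝ) 1, costFun ε q σ C t < c := by
    obtain ⟨t, ⟨ht0, ht1⟩, ht⟩ := exists_costFun_eq_rate (q := q) (σ := σ) (C := C) hε1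
    rcases ht1.eq_or_lt with rfl | ht1
    · have h1 : ∀ᶠ s in 𝓝[<] (1 : ℝ), costFun ε q σ C s < c :=
        ((continuous_costFun hε1).continuousAt.eventually
          (gt_mem_nhds (ht.trans_lt hc))).filter_mono nhdsWithin_le_nhds
      obtain ⟨s, hs, hs'⟩ := (h1.and (Ioo_mem_nhdsLT zero_lt_one)).exists
      exact ⟨s, ⟨hs'.1.le, hs'.2⟩, hs⟩
    · exact ⟨t, ⟨ht0, ht1⟩, ht.trans_lt hc⟩
  exact eventually_exp_le_sumTail_of_costFun_lt hindep hident hL2 h0 hvar hσ hε0 hε1 hq hC htail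
    ht.1 ht.2 hct

end LowerBound

/-! ### Exponential moments from tail bounds -/

section Moments

variable {Ω : Type*} [MeasurableSpace Ω] {P : Measure Ω} [IsProbabilityMeasure P]

lemma integrable_exp_mul_of_tail_le {Z : Ω → ℝ} (hZ : AEMeasurable Z P) (hZ0 : ∀ ω, 0 ≤ Z ω)
    {r s : ℝ} (hr : 0 ≤ r) (hrs : r < s)
    (h : ∀ᶠ z : ℝ in atTop, P.real {ω | z ≤ Z ω} ≤ Real.exp (-s * z)) :
    Integrable (fun ω => Real.exp (r * Z ω)) P := by
  refine ⟨(Real.measurable_exp.comp_aemeasurable (hZ.const_mul r)).aestronglyMeasurable, ?_⟩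
  rw [hasFiniteIntegral_iff_ofReal (Eventually.of_forall fun ω => (Real.exp_pos _).le)]
  have hnull : ∀ k : ℕ, NullMeasurableSet {ω | (k : ℝ) ≤ Z ω} P := fun k =>
    hZ.nullMeasurableSet_preimage measurableSet_Ici
  have hsum : Summable fun k : ℕ =>
      Real.exp (r * (k + 1)) * P.real {ω | (k : ℝ) ≤ Z ω} := by
    have hgeo : Summable fun k : ℕ => Real.exp r * Real.exp (-(s - r)) ^ k :=
      (summable_geometric_of_lt_one (Real.exp_pos _).le
        (by rw [Real.exp_lt_one_iff]; linarith)).mul_left _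
    refine Summable.of_norm_bounded_eventually_nat hgeo ?_
    filter_upwards [tendsto_natCast_atTop_atTop.eventually h] with k hk
    rw [Real.norm_of_nonneg (by positivity), ← Real.exp_nat_mul, ← Real.exp_add]
    calc _ ≤ Real.exp (r * (k + 1)) * Real.exp (-s * k) :=
          mul_le_mul_of_nonneg_left hk (Real.exp_pos _).le
      _ = _ := by rw [← Real.exp_add]; congr 1; ring
  -- Cut according to the integer part of `Z`.
  have hpt : ∀ ω, ENNReal.ofReal (Real.exp (r * Z ω)) ≤
      ∑' k : ℕ, {ω | (k : ℝ) ≤ Z ω}.indicator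
        (fun _ => ENNReal.ofReal (Real.exp (r * (k + 1)))) ω := by
    intro ω
    refine le_trans ?_ (ENNReal.le_tsum ⌊Z ω⌋₊)
    have hmem : ω ∈ {ω' | (⌊Z ω⌋₊ : ℝ) ≤ Z ω'} := Nat.floor_le (hZ0 ω)
    rw [Set.indicator_of_mem hmem]
    refine ENNReal.ofReal_le_ofReal (Real.exp_le_exp.2 ?_)
    exact mul_le_mul_of_nonneg_left (Nat.lt_floor_add_one _).le hr
  refine (lintegral_mono hpt).trans_lt ?_
  rw [lintegral_tsum fun k => aemeasurable_const.indicator₀ (hnull k)]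
  simp_rw [lintegral_indicator_const₀ (hnull _)]
  have e : ∀ k : ℕ, ENNReal.ofReal (Real.exp (r * (k + 1))) * P {ω | (k : ℝ) ≤ Z ω} =
      ENNReal.ofReal (Real.exp (r * (k + 1)) * P.real {ω | (k : ℝ) ≤ Z ω}) := by
    intro k
    rw [ENNReal.ofReal_mul (Real.exp_pos _).le, ofReal_measureReal]
  simp_rw [e]
  exact hsum.tsum_ofReal_lt_top

variable {X : Ω → ℝ} {p q' q'' : ℝ}

lemma integrable_exp_rpow_of_tail_le (hX : AEMeasurable X P) (hp : 0 < p) (hq' : 0 ≤ q')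
    (hqq : q' < q'')
    (h : ∀ᶠ x : ℝ in atTop, P.real {ω | x ≤ X ω} ≤ Real.exp (-q'' * x ^ p)) :
    Integrable (fun ω => Real.exp (q' * (max (X ω) 0) ^ p)) P := by
  refine integrable_exp_mul_of_tail_le ((hX.max aemeasurable_const).pow_const p)
    (fun ω => by positivity) hq' hqq ?_
  have hlim : Tendsto (fun z : ℝ => z ^ p⁻¹) atTop atTop := tendsto_rpow_atTop (by positivity)
  filter_upwards [hlim.eventually h, eventually_gt_atTop 0] with z hz hz0
  rw [← Real.rpow_mul hz0.le, inv_mul_cancel₀ hp.ne', Real.rpow_one] at hz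
  refine le_trans (measureReal_mono fun ω (hω : z ≤ max (X ω) 0 ^ p) => ?_) hz
  have h1 : z ^ p⁻¹ ≤ max (X ω) 0 := by
    rwa [Real.rpow_inv_le_iff_of_pos hz0.le (by positivity) hp]
  have h2 : 0 < z ^ p⁻¹ := Real.rpow_pos_of_pos hz0 _
  exact (le_max_iff.1 h1).resolve_right (by linarith)

/-- The factor `X²` is absorbed by an increase of `q'` where `X > 0`, and is integrable by itself
where `X ≤ 0`. -/
lemma integrable_sq_mul_exp_rpow_of_tail_le (hX : MemLp X 2 P) (hp : 0 < p) (hq' : 0 ≤ q')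
    (hqq : q' < q'')
    (h : ∀ᶠ x : ℝ in atTop, P.real {ω | x ≤ X ω} ≤ Real.exp (-q'' * x ^ p)) :
    Integrable (fun ω => X ω ^ 2 * Real.exp (q' * (max (X ω) 0) ^ p)) P := by
  have hm := hX.aestronglyMeasurable.aemeasurable
  obtain ⟨r, hr1, hr2⟩ := exists_between hqq
  have hd : 0 < (r - q') / (2 / p) := div_pos (by linarith) (by positivity)
  set d := (r - q') / (2 / p) with hdef
  have hI := integrable_exp_rpow_of_tail_le hm hp (by linarith : 0 ≤ r) hr2 h
  refine (hX.integrable_sq.add (hI.const_mul ((d ^ (2 / p))⁻¹))).mono'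
    ((hm.pow_const 2).mul (Real.measurable_exp.comp_aemeasurable
      (((hm.max aemeasurable_const).pow_const p).const_mul q'))).aestronglyMeasurable
    (Eventually.of_forall fun ω => ?_)
  rw [Real.norm_of_nonneg (by positivity)]
  simp only [Pi.add_apply]
  rcases le_or_gt (X ω) 0 with h0 | h0
  · rw [max_eq_right h0, Real.zero_rpow hp.ne']
    simp only [mul_zero, Real.exp_zero, mul_one, le_add_iff_nonneg_right]
    positivity
  · rw [max_eq_left h0.le]
    set z := X ω ^ p with hz
    have hz0 : 0 < z := Real.rpow_pos_of_pos h0 _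
    have h1 : X ω ^ 2 = z ^ (2 / p) := by
      rw [hz, ← Real.rpow_mul h0.le, mul_div_cancel₀ _ hp.ne']
      norm_cast
    -- `d z ≤ exp (d z)`, raised to the power `2 / p`.
    have h2 : d ^ (2 / p) * z ^ (2 / p) ≤ Real.exp ((r - q') * z) := by
      rw [← Real.mul_rpow hd.le hz0.le]
      calc (d * z) ^ (2 / p) ≤ Real.exp (d * z) ^ (2 / p) :=
            Real.rpow_le_rpow (by positivity) (by linarith [Real.add_one_le_exp (d * z)])
              (by positivity)
        _ = _ := by
          rw [← Real.exp_mul]; congr 1; rw [hdef]; field_simp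
    have h3 : X ω ^ 2 * Real.exp (q' * z) ≤ (d ^ (2 / p))⁻¹ * Real.exp (r * z) := by
      have hdp : 0 < d ^ (2 / p) := Real.rpow_pos_of_pos hd _
      rw [h1, inv_mul_eq_div, le_div_iff₀ hdp]
      calc z ^ (2 / p) * Real.exp (q' * z) * d ^ (2 / p)
          = (d ^ (2 / p) * z ^ (2 / p)) * Real.exp (q' * z) := by ring
        _ ≤ Real.exp ((r - q') * z) * Real.exp (q' * z) :=
          mul_le_mul_of_nonneg_right h2 (Real.exp_pos _).le
        _ = _ := by rw [← Real.exp_add]; congr 1; ring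
    have := sq_nonneg (X ω)
    linarith

end Moments

/-! ### The truncated exponential moment -/

/-- The exponent used in Chernoff's inequality: linear with slope `lam` up to the truncation level
`z`, and `q' y ^ p` above it. -/
noncomputable def truncExponent (p q' lam z y : ℝ) : ℝ :=
  if y ≤ z then lam * y else q' * y ^ p

section TruncExponent

variable {p q' lam z y μ θ : ℝ}

lemma measurable_truncExponent : Measurable (truncExponent p q' lam z) :=
  Measurable.ite measurableSet_Iic (measurable_const_mul lam)
    ((measurable_id.pow_const p).const_mul q')

lemma truncExponent_le (hz : 0 ≤ z) (hlam : 0 ≤ lam)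
    (hq' : 0 ≤ q') (h : ∀ y, 0 < y → y ≤ z → lam * y ≤ q' * y ^ p) :
    truncExponent p q' lam z y ≤ q' * (max y 0) ^ p := by
  unfold truncExponent
  split_ifs with hy
  · rcases le_or_gt y 0 with h0 | h0
    · exact (mul_nonpos_of_nonneg_of_nonpos hlam h0).trans (by positivity)
    · rw [max_eq_left h0.le]; exact h y h0 hy
  · rw [max_eq_left (by linarith)]

lemma abs_exp_sub_one_sub_le (hθ : 0 ≤ θ) (hy : y ≤ θ) :
    |Real.exp y - 1 - y| ≤ y ^ 2 * Real.exp θ := by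
  have h1 : 1 ≤ Real.exp θ := Real.one_le_exp hθ
  have h2 : 0 ≤ Real.exp y - 1 - y := by linarith [Real.add_one_le_exp y]
  by_cases hle : |y| ≤ 1
  · exact (Real.abs_exp_sub_one_sub_id_le hle).trans (by nlinarith [sq_nonneg y])
  · rw [abs_of_nonneg h2]
    have h4 : Real.exp y ≤ Real.exp θ := Real.exp_le_exp.2 hy
    rcases lt_abs.1 (not_le.1 hle) with h3 | h3
    · have : 1 ≤ y ^ 2 := by nlinarith
      nlinarith
    · have : Real.exp y ≤ 1 := Real.exp_le_one_iff.2 (by linarith)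
      nlinarith

/-- A bound on the second-order remainder by `μ²` times a function of `y` alone. For `μ y ≤ 1` it is
Taylor's formula; for `μ y > 1` the factor `(μ y)² ≥ 1` pays for the terms that are not small. -/
lemma abs_exp_truncExponent_sub_le (hθ : 0 ≤ θ) (hμ : 0 < μ) (hq' : 0 ≤ q')
    (hz : 1 ≤ μ * z) (h : ∀ y, 0 < y → y ≤ z → θ * μ * y ≤ q' * y ^ p) :
    |Real.exp (truncExponent p q' (θ * μ) z y) - 1 - θ * μ * y| ≤
      μ ^ 2 * ((θ ^ 2 * Real.exp θ + 1 + θ) * (y ^ 2 * Real.exp (q' * (max y 0) ^ p))) := by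
  have hz0 : 0 ≤ z := by
    by_contra! h0
    nlinarith
  have hE : 1 ≤ Real.exp (q' * (max y 0) ^ p) := Real.one_le_exp (by positivity)
  rcases le_or_gt (μ * y) 1 with hy | hy
  · have hyz : y ≤ z := le_of_mul_le_mul_left (hy.trans hz) hμ
    rw [truncExponent, if_pos hyz]
    refine (abs_exp_sub_one_sub_le hθ (by nlinarith)).trans ?_
    have h1 : 0 ≤ μ ^ 2 * y ^ 2 * (θ ^ 2 * Real.exp θ) := by positivity
    have h2 : 0 ≤ μ ^ 2 * ((1 + θ) * (y ^ 2 * Real.exp (q' * (max y 0) ^ p))) := by positivity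
    have h3 := mul_le_mul_of_nonneg_left hE h1
    linarith
  · have hy0 : 0 < y := by
      by_contra! h0
      nlinarith
    have hle := truncExponent_le (z := z) (y := y) hz0 (by positivity) hq' h
    have hle' := Real.exp_le_exp.2 hle
    have hpos := Real.exp_pos (truncExponent p q' (θ * μ) z y)
    have hge : 0 ≤ truncExponent p q' (θ * μ) z y := by
      unfold truncExponent
      split_ifs <;> positivity
    have hge' := Real.one_le_exp hge
    set E := Real.exp (q' * (max y 0) ^ p)
    have h1 : 1 ≤ (μ * y) ^ 2 := one_le_pow₀ hy.le
    have h2 : μ * y ≤ (μ * y) ^ 2 := by nlinarith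
    have hA : E ≤ (μ * y) ^ 2 * E := by nlinarith
    have hB : θ * (μ * y) ≤ θ * ((μ * y) ^ 2 * E) :=
      mul_le_mul_of_nonneg_left (h2.trans (by nlinarith)) hθ
    have hθy : 0 ≤ θ * (μ * y) := by positivity
    have hD : 0 ≤ (θ ^ 2 * Real.exp θ) * ((μ * y) ^ 2 * E) := by positivity
    rw [abs_le]
    constructor <;> nlinarith

lemma tendsto_exp_sub_one_sub_div_sq :
    Tendsto (fun u : ℝ => (Real.exp u - 1 - u) / u ^ 2) (𝓝[≠] 0) (𝓝 (1 / 2)) := by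
  have hlim : Tendsto (fun u : ℝ => |u|) (𝓝[≠] 0) (𝓝 0) := by
    have := (continuous_abs (G := ℝ)).tendsto 0
    rw [abs_zero] at this
    exact this.mono_left nhdsWithin_le_nhds
  rw [tendsto_iff_dist_tendsto_zero]
  refine squeeze_zero' (Eventually.of_forall fun _ => dist_nonneg) ?_ hlim
  filter_upwards [self_mem_nhdsWithin,
    hlim.eventually (gt_mem_nhds zero_lt_one)] with u hu hu1
  have hb := Real.exp_bound hu1.le (n := 3) (by norm_num)
  simp only [Finset.sum_range_succ, Finset.sum_range_zero] at hb
  norm_num [Nat.factorial] at hb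
  have hu' : u ≠ 0 := hu
  have hu0 : 0 < u ^ 2 := by positivity
  rw [Real.dist_eq, show (Real.exp u - 1 - u) / u ^ 2 - 1 / 2 =
    (Real.exp u - (1 + u + u ^ 2 / 2)) / u ^ 2 by field_simp; ring, abs_div, abs_of_pos hu0,
    div_le_iff₀ hu0]
  refine hb.trans ?_
  have : |u| ^ 3 = |u| * u ^ 2 := by rw [pow_succ' |u| 2, sq_abs]
  have h0 : 0 ≤ |u| * u ^ 2 := by positivity
  rw [this]
  linarith

lemma tendsto_exp_mul_sub_div_sq {μ : ℕ → ℝ} (hμ : ∀ᶠ n in atTop, 0 < μ n)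
    (hμ0 : Tendsto μ atTop (𝓝 0)) (a : ℝ) :
    Tendsto (fun n => (Real.exp (a * μ n) - 1 - a * μ n) / μ n ^ 2) atTop (𝓝 (a ^ 2 / 2)) := by
  rcases eq_or_ne a 0 with rfl | ha
  · simp
  have h1 : Tendsto (fun n => a * μ n) atTop (𝓝[≠] 0) := by
    refine tendsto_nhdsWithin_iff.2 ⟨by simpa using hμ0.const_mul a, ?_⟩
    filter_upwards [hμ] with n hn
    exact mul_ne_zero ha hn.ne'
  have h2 := (tendsto_exp_sub_one_sub_div_sq.comp h1).const_mul (a ^ 2)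
  rw [mul_one_div] at h2
  refine h2.congr' ?_
  filter_upwards [hμ] with n hn
  simp only [Function.comp_apply]
  field_simp

/-- Second-order expansion of the truncated exponential moment as the slope `θ μ_n` tends to `0`
while the truncation level is at least `1 / μ_n`. Only second moments are needed on the left. -/
lemma tendsto_integral_exp_truncExponent {Ω : Type*} [MeasurableSpace Ω] {P : Measure Ω}
    [IsProbabilityMeasure P] {X : Ω → ℝ} {q'' : ℝ} (hX : MemLp X 2 P) (h0 : ∫ ω, X ω ∂P = 0)
    (hp : 0 < p) (hq' : 0 ≤ q') (hqq : q' < q'')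
    (htail : ∀ᶠ x : ℝ in atTop, P.real {ω | x ≤ X ω} ≤ Real.exp (-q'' * x ^ p))
    (hθ : 0 ≤ θ) {μ z : ℕ → ℝ} (hμ : ∀ᶠ n in atTop, 0 < μ n) (hμ0 : Tendsto μ atTop (𝓝 0))
    (hz : ∀ᶠ n in atTop, 1 ≤ μ n * z n)
    (hlin : ∀ᶠ n in atTop, ∀ y, 0 < y → y ≤ z n → θ * μ n * y ≤ q' * y ^ p) :
    (∀ᶠ n in atTop, Integrable
      (fun ω => Real.exp (truncExponent p q' (θ * μ n) (z n) (X ω))) P) ∧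
    Tendsto (fun n => (∫ ω, Real.exp (truncExponent p q' (θ * μ n) (z n) (X ω)) ∂P - 1) / μ n ^ 2)
      atTop (𝓝 (θ ^ 2 * variance X P / 2)) := by
  have hm := hX.aestronglyMeasurable.aemeasurable
  have hX1 : Integrable X P := hX.integrable (by norm_num)
  have hmeas : ∀ n, AEStronglyMeasurable
      (fun ω => Real.exp (truncExponent p q' (θ * μ n) (z n) (X ω))) P := fun n =>
    (Real.measurable_exp.comp_aemeasurable
      (measurable_truncExponent.comp_aemeasurable hm)).aestronglyMeasurable
  have hint : ∀ᶠ n in atTop, Integrable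
      (fun ω => Real.exp (truncExponent p q' (θ * μ n) (z n) (X ω))) P := by
    filter_upwards [hμ, hz, hlin] with n h1 h2 h3
    have hz0 : 0 ≤ z n := by
      by_contra! h0
      nlinarith
    refine (integrable_exp_rpow_of_tail_le hm hp hq' hqq htail).mono' (hmeas n)
      (Eventually.of_forall fun ω => ?_)
    rw [Real.norm_of_nonneg (Real.exp_pos _).le]
    exact Real.exp_le_exp.2 (truncExponent_le hz0 (by positivity) hq' h3)
  refine ⟨hint, ?_⟩
  have hztop : Tendsto z atTop atTop := by
    have hinv : Tendsto (fun n => (μ n)⁻¹) atTop atTop :=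
      tendsto_inv_nhdsGT_zero.comp (tendsto_nhdsWithin_iff.2 ⟨hμ0, hμ⟩)
    refine tendsto_atTop_mono' _ ?_ hinv
    filter_upwards [hμ, hz] with n h1 h2
    rwa [inv_le_iff_one_le_mul₀' h1]
  have hdct := tendsto_integral_filter_of_dominated_convergence (μ := P) (l := atTop)
    (F := fun n ω => (Real.exp (truncExponent p q' (θ * μ n) (z n) (X ω)) - 1 -
      θ * μ n * X ω) / μ n ^ 2) (f := fun ω => (θ * X ω) ^ 2 / 2)
    (fun ω => (θ ^ 2 * Real.exp θ + 1 + θ) * (X ω ^ 2 * Real.exp (q' * (max (X ω) 0) ^ p)))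
    (Eventually.of_forall fun n => by
      exact ((((hmeas n).aemeasurable.sub_const 1).sub
        (hm.const_mul _)).div_const _).aestronglyMeasurable)
    (by
      filter_upwards [hμ, hz, hlin] with n h1 h2 h3
      refine Eventually.of_forall fun ω => ?_
      rw [Real.norm_eq_abs, abs_div, abs_of_pos (pow_pos h1 2), div_le_iff₀ (pow_pos h1 2),
        mul_comm _ (μ n ^ 2)]
      exact abs_exp_truncExponent_sub_le hθ h1 hq' h2 h3)
    ((integrable_sq_mul_exp_rpow_of_tail_le hX hp hq' hqq htail).const_mul _)
    (Eventually.of_forall fun ω => by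
      refine (tendsto_exp_mul_sub_div_sq hμ hμ0 (θ * X ω)).congr' ?_
      filter_upwards [hztop.eventually_ge_atTop (X ω)] with n hn
      rw [truncExponent, if_pos hn, mul_right_comm])
  have hvar : ∫ ω, (θ * X ω) ^ 2 / 2 ∂P = θ ^ 2 * variance X P / 2 := by
    rw [variance_of_integral_eq_zero hm h0, integral_div]
    simp_rw [mul_pow]
    rw [integral_const_mul]
  rw [hvar] at hdct
  refine hdct.congr' ?_
  filter_upwards [hint] with n hn
  have hn1 : Integrable
      (fun ω => Real.exp (truncExponent p q' (θ * μ n) (z n) (X ω)) - 1) P :=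
    hn.sub (integrable_const 1)
  rw [integral_div, integral_sub hn1 (hX1.const_mul _),
    integral_sub hn (integrable_const 1), integral_const_mul, h0]
  simp

end TruncExponent

/-! ### The upper bound -/

/-- The part of the sum `S_n` made of the summands that are at most `z`. -/
noncomputable def smallSum {Ω : Type*} (Y : ℕ → Ω → ℝ) (n : ℕ) (z : ℝ) (ω : Ω) : ℝ :=
  ∑ i ∈ Finset.range n, if Y i ω ≤ z then Y i ω else 0

/-- The part of the sum `S_n` made of the summands that exceed `z`. -/
noncomputable def bigSum {Ω : Type*} (Y : ℕ → Ω → ℝ) (n : ℕ) (z : ℝ) (ω : Ω) : ℝ :=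
  ∑ i ∈ Finset.range n, if Y i ω ≤ z then 0 else Y i ω

section Deterministic

variable {Ω : Type*} {Y : ℕ → Ω → ℝ} {n : ℕ} {p q' lam z : ℝ} {ω : Ω}

lemma smallSum_add_bigSum : smallSum Y n z ω + bigSum Y n z ω = ∑ i ∈ Finset.range n, Y i ω := by
  rw [smallSum, bigSum, ← Finset.sum_add_distrib]
  refine Finset.sum_congr rfl fun i _ => ?_
  split_ifs <;> simp

lemma bigSum_nonneg (hz : 0 ≤ z) : 0 ≤ bigSum Y n z ω :=
  Finset.sum_nonneg fun i _ => by split_ifs <;> linarith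

lemma rpow_sum_le_sum_rpow {ι : Type*} (s : Finset ι) {b : ι → ℝ} (hb : ∀ i, 0 ≤ b i)
    (hp0 : 0 < p) (hp1 : p ≤ 1) : (∑ i ∈ s, b i) ^ p ≤ ∑ i ∈ s, b i ^ p := by
  classical
  induction s using Finset.induction_on with
  | empty => simp [Real.zero_rpow hp0.ne']
  | insert i s hi ih =>
    rw [Finset.sum_insert hi, Finset.sum_insert hi]
    exact (Real.rpow_add_le_add_rpow (hb i) (Finset.sum_nonneg fun j _ => hb j) hp0.le hp1).trans
      (by linarith)

/-- By subadditivity of `y ^ p`, one big jump is the cheapest way to realise a given `bigSum`. -/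
lemma le_sum_truncExponent (hp0 : 0 < p) (hp1 : p ≤ 1) (hq' : 0 ≤ q') (hz : 0 ≤ z) :
    lam * smallSum Y n z ω + q' * bigSum Y n z ω ^ p ≤
      ∑ i ∈ Finset.range n, truncExponent p q' lam z (Y i ω) := by
  have h1 := rpow_sum_le_sum_rpow (Finset.range n) (b := fun i => if Y i ω ≤ z then 0 else Y i ω)
    (fun i => by split_ifs <;> linarith) hp0 hp1
  have h2 : ∑ i ∈ Finset.range n, truncExponent p q' lam z (Y i ω) = lam * smallSum Y n z ω +
      q' * ∑ i ∈ Finset.range n, (if Y i ω ≤ z then 0 else Y i ω) ^ p := by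
    rw [smallSum, Finset.mul_sum, Finset.mul_sum, ← Finset.sum_add_distrib]
    refine Finset.sum_congr rfl fun i _ => ?_
    unfold truncExponent
    split_ifs <;> simp [Real.zero_rpow hp0.ne']
  rw [h2, bigSum]
  have := mul_le_mul_of_nonneg_left h1 hq'
  linarith

end Deterministic

section UpperBound

variable {Ω : Type*} [MeasurableSpace Ω] {P : Measure Ω} [IsProbabilityMeasure P]
  {Y : ℕ → Ω → ℝ} {ε q q' σ C : ℝ}

lemma measureReal_sum_ge_le_exp_mul_pow (hindep : iIndepFun Y P)
    (hident : ∀ i, IdentDistrib (Y i) (Y 0) P P) {φ : ℝ → ℝ} (hφ : Measurable φ)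
    (hint : Integrable (fun ω => Real.exp (φ (Y 0 ω))) P) (n : ℕ) (x : ℝ) :
    P.real {ω | x ≤ ∑ i ∈ Finset.range n, φ (Y i ω)} ≤
      Real.exp (-x) * (∫ ω, Real.exp (φ (Y 0 ω)) ∂P) ^ n := by
  have hind : iIndepFun (fun i => φ ∘ Y i) P := hindep.comp (fun _ => φ) fun _ => hφ
  have hid i : IdentDistrib (φ ∘ Y i) (φ ∘ Y 0) P P := (hident i).comp hφ
  have hmgf : mgf (∑ i ∈ Finset.range n, φ ∘ Y i) P 1 =
      (∫ ω, Real.exp (φ (Y 0 ω)) ∂P) ^ n := by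
    rw [hind.mgf_sum₀ fun i => (hid i).aemeasurable_fst]
    have : ∀ i, mgf (φ ∘ Y i) P 1 = ∫ ω, Real.exp (φ (Y 0 ω)) ∂P := by
      intro i
      have h := ((hid i).comp (u := fun y => Real.exp y) Real.measurable_exp).integral_eq
      simpa [mgf] using h
    simp [this]
  have hpos : 0 < ∫ ω, Real.exp (φ (Y 0 ω)) ∂P := integral_exp_pos hint
  -- The exponential of the sum is integrable, since otherwise its Bochner integral would be `0`.
  have hint' : Integrable (fun ω => Real.exp (1 * (∑ i ∈ Finset.range n, φ ∘ Y i) ω)) P := by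
    refine Integrable.of_integral_ne_zero ?_
    change mgf (∑ i ∈ Finset.range n, φ ∘ Y i) P 1 ≠ 0
    rw [hmgf]
    positivity
  have := measure_ge_le_exp_mul_mgf x zero_le_one hint'
  rw [hmgf] at this
  simpa using this

/-- Joint Chernoff bound for the small and the big summands. The inequality for `smallSum` is
multiplied by `θ`, so that it is void for `θ = 0`. -/
lemma eventually_measureReal_smallSum_bigSum_le (hindep : iIndepFun Y P)
    (hident : ∀ i, IdentDistrib (Y i) (Y 0) P P) (hL2 : MemLp (Y 0) 2 P)
    (h0 : ∫ ω, Y 0 ω ∂P = 0) (hvar : variance (Y 0) P = σ ^ 2)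
    (hε0 : 0 < ε) (hε1 : ε < 1) (hC : 0 < C) (hq' : 0 ≤ q') (hqq : q' < q)
    (htail : ∀ᶠ x : ℝ in atTop, P.real {ω | x ≤ Y 0 ω} ≤ Real.exp (-q * x ^ (1 - ε)))
    {η θ κ : ℝ} (hη : 0 < η) (hθ : 0 ≤ θ) (hηθ : θ * (η ^ ε * C ^ (1 + ε)) ≤ q') (hκ : 0 < κ)
    (a : ℝ) {b : ℝ} (hb : 0 ≤ b) :
    ∀ᶠ n : ℕ in atTop, P.real {ω |
        θ * (a * level ε C n) ≤ θ * smallSum Y n (η * level ε C n) ω ∧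
        b * level ε C n ≤ bigSum Y n (η * level ε C n) ω} ≤
      Real.exp (-(θ * a - θ ^ 2 * σ ^ 2 / 2 - κ + q' * b ^ (1 - ε) / C ^ (1 + ε)) *
        speed ε C n) := by
  have hp0 : 0 < 1 - ε := by linarith
  have hμ : ∀ᶠ n : ℕ in atTop, 0 < level ε C n / n := by
    filter_upwards [eventually_gt_atTop 0] with n hn
    exact div_pos (level_pos hC hn) (by exact_mod_cast hn)
  have hz : ∀ᶠ n : ℕ in atTop, 1 ≤ level ε C n / n * (η * level ε C n) := by
    filter_upwards [(tendsto_speed hε0 hε1 hC).eventually_ge_atTop (1 / η)] with n hn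
    rw [div_le_iff₀ hη, speed] at hn
    calc (1 : ℝ) ≤ level ε C n ^ 2 / n * η := hn
      _ = _ := by ring
  have hlin : ∀ᶠ n : ℕ in atTop, ∀ y, 0 < y → y ≤ η * level ε C n →
      θ * (level ε C n / n) * y ≤ q' * y ^ (1 - ε) := by
    filter_upwards [eventually_gt_atTop 0] with n hn y hy hyz
    have hx := level_pos (ε := ε) hC hn
    have hn' : (0 : ℝ) < n := by exact_mod_cast hn
    have e1 : y = y ^ ε * y ^ (1 - ε) := by rw [← Real.rpow_add hy]; simp
    have e2 : y ^ ε ≤ η ^ ε * level ε C n ^ ε := by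
      rw [← Real.mul_rpow hη.le hx.le]
      exact Real.rpow_le_rpow hy.le hyz hε0.le
    have e3 : level ε C n * level ε C n ^ ε = C ^ (1 + ε) * n := by
      rw [← level_rpow_one_add hε0 hC, Real.rpow_add hx, Real.rpow_one]
    have hyp : 0 < y ^ (1 - ε) := Real.rpow_pos_of_pos hy _
    calc θ * (level ε C n / n) * y = θ * (level ε C n / n) * y ^ ε * y ^ (1 - ε) := by
          nth_rw 1 [e1]; ring
      _ ≤ θ * (level ε C n / n) * (η ^ ε * level ε C n ^ ε) * y ^ (1 - ε) := by gcongr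
      _ = θ * (η ^ ε * (level ε C n * level ε C n ^ ε / n)) * y ^ (1 - ε) := by ring
      _ = θ * (η ^ ε * C ^ (1 + ε)) * y ^ (1 - ε) := by rw [e3]; field_simp
      _ ≤ q' * y ^ (1 - ε) := mul_le_mul_of_nonneg_right hηθ hyp.le
  obtain ⟨hint, hlim⟩ := tendsto_integral_exp_truncExponent hL2 h0 hp0 hq' hqq htail hθ hμ
    (tendsto_level_div hε0) hz hlin
  rw [hvar] at hlim
  have hlt := hlim.eventually
    (gt_mem_nhds (show θ ^ 2 * σ ^ 2 / 2 < θ ^ 2 * σ ^ 2 / 2 + κ by linarith))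
  filter_upwards [hint, hlt, hμ, eventually_gt_atTop 0] with n h1 h2 h3 hn
  have hx := level_pos (ε := ε) hC hn
  have hn' : (0 : ℝ) < n := by exact_mod_cast hn
  have hL := speed_pos (ε := ε) hC hn
  have hCp : 0 < C ^ (1 + ε) := Real.rpow_pos_of_pos hC _
  set lam := θ * (level ε C n / n) with hlam
  set M := ∫ ω, Real.exp (truncExponent (1 - ε) q' lam (η * level ε C n) (Y 0 ω)) ∂P
  have hM0 : 0 ≤ M := integral_nonneg fun _ => (Real.exp_pos _).le
  have hM : M ^ n ≤ Real.exp ((θ ^ 2 * σ ^ 2 / 2 + κ) * speed ε C n) := by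
    rw [div_lt_iff₀ (pow_pos h3 2)] at h2
    have hM1 : M ≤ Real.exp ((θ ^ 2 * σ ^ 2 / 2 + κ) * (level ε C n / n) ^ 2) :=
      le_trans (by linarith) (Real.add_one_le_exp _)
    refine (pow_le_pow_left₀ hM0 hM1 n).trans (le_of_eq ?_)
    rw [← Real.exp_nat_mul, speed]
    congr 1
    field_simp
  have hsub : {ω | θ * (a * level ε C n) ≤ θ * smallSum Y n (η * level ε C n) ω ∧
        b * level ε C n ≤ bigSum Y n (η * level ε C n) ω} ⊆
      {ω | (θ * a + q' * b ^ (1 - ε) / C ^ (1 + ε)) * speed ε C n ≤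
        ∑ i ∈ Finset.range n, truncExponent (1 - ε) q' lam (η * level ε C n) (Y i ω)} := by
    rintro ω ⟨hA, hB⟩
    refine le_trans ?_ (le_sum_truncExponent hp0 (by linarith) hq' (by positivity))
    have e1 : θ * a * speed ε C n ≤ lam * smallSum Y n (η * level ε C n) ω := by
      calc θ * a * speed ε C n = θ * (a * level ε C n) * (level ε C n / n) := by
            rw [speed]; ring
        _ ≤ θ * smallSum Y n (η * level ε C n) ω * (level ε C n / n) :=
          mul_le_mul_of_nonneg_right hA h3.le
        _ = _ := by rw [hlam]; ring
    have e2 : q' * b ^ (1 - ε) / C ^ (1 + ε) * speed ε C n ≤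
        q' * bigSum Y n (η * level ε C n) ω ^ (1 - ε) := by
      calc q' * b ^ (1 - ε) / C ^ (1 + ε) * speed ε C n
          = q' * (b * level ε C n) ^ (1 - ε) := by
            rw [Real.mul_rpow hb hx.le, level_rpow_one_sub hε0 hC hn]; ring
        _ ≤ _ := mul_le_mul_of_nonneg_left
          (Real.rpow_le_rpow (by positivity) hB hp0.le) hq'
    linarith
  refine (measureReal_mono hsub).trans ?_
  refine (measureReal_sum_ge_le_exp_mul_pow hindep hident measurable_truncExponent h1 n _).trans ?_
  refine (mul_le_mul_of_nonneg_left hM (Real.exp_pos _).le).trans (le_of_eq ?_)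
  rw [← Real.exp_add]
  congr 1
  ring

/-- The event `S_n ≥ x` is covered by finitely many cells: the small summands contribute at least
`(j / N) x`, and the big ones at least `(1 - (j + 1) / N) x`. -/
lemma exists_cell {N : ℕ} (hN : 0 < N) {A B x θ : ℝ} (hx : 0 < x) (hθ : 0 ≤ θ) (hB : 0 ≤ B)
    (h : x ≤ A + B) : ∃ j ∈ Finset.range (N + 1),
      θ * (j / N) * ((j / N : ℝ) * x) ≤ θ * (j / N) * A ∧
        max (1 - ((j + 1 : ℕ) : ℝ) / N) 0 * x ≤ B := by
  have hN' : (0 : ℝ) < N := by exact_mod_cast hN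
  refine ⟨min ⌊A / x * N⌋₊ N, Finset.mem_range.2 (by omega), ?_, ?_⟩
  · rcases Nat.eq_zero_or_pos (min ⌊A / x * N⌋₊ N) with h0 | h0
    · rw [h0]; simp
    · refine mul_le_mul_of_nonneg_left ?_ (by positivity)
      have hpos : 0 < ⌊A / x * N⌋₊ := h0.trans_le (min_le_left _ _)
      have h1 : ((min ⌊A / x * N⌋₊ N : ℕ) : ℝ) ≤ A / x * N :=
        (Nat.cast_le.2 (min_le_left _ _)).trans
          (Nat.floor_le (by
            by_contra! hneg
            rw [Nat.floor_of_nonpos hneg.le] at hpos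
            exact lt_irrefl _ hpos))
      rw [← le_div_iff₀ hx, div_le_iff₀ hN']
      exact h1
  · rw [max_mul_of_nonneg _ _ hx.le, zero_mul, max_le_iff]
    refine ⟨?_, hB⟩
    rcases le_total ⌊A / x * N⌋₊ N with hle | hle
    · rw [min_eq_left hle]
      have h1 := Nat.lt_floor_add_one (A / x * N)
      have h2 : A < (((⌊A / x * N⌋₊ + 1 : ℕ) : ℝ) / N) * x := by
        rw [← div_lt_iff₀ hx, lt_div_iff₀ hN']
        push_cast
        exact h1
      linarith
    · rw [min_eq_right hle]
      have h1 : 1 - ((N + 1 : ℕ) : ℝ) / N ≤ 0 := by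
        rw [sub_nonpos, le_div_iff₀ hN']
        push_cast
        linarith
      nlinarith

/-- The Chernoff exponent of each cell is close to a value of `f`. -/
lemma rate_sub_le_cell_exponent (hε1 : ε < 1) (hσ : σ ≠ 0) (hC : 0 < C) (hq'0 : 0 ≤ q')
    {d : ℝ} (hd : 0 ≤ d) (hqd : (q - q') / C ^ (1 + ε) ≤ d) {N : ℕ} (hN : 0 < N)
    (hNd : 1 / (N * σ ^ 2) ≤ d) {j : ℕ} (hj : j ≤ N) :
    rate ε q σ C - 3 * d ≤ 1 / σ ^ 2 * (j / N) * (j / N) -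
      (1 / σ ^ 2 * (j / N)) ^ 2 * σ ^ 2 / 2 - d +
      q' * (max (1 - ((j + 1 : ℕ) : ℝ) / N) 0) ^ (1 - ε) / C ^ (1 + ε) := by
  have hN' : (0 : ℝ) < N := by exact_mod_cast hN
  have hCp : 0 < C ^ (1 + ε) := Real.rpow_pos_of_pos hC _
  have e1 : 1 / σ ^ 2 * (j / N : ℝ) * (j / N) - (1 / σ ^ 2 * (j / N : ℝ)) ^ 2 * σ ^ 2 / 2 =
      (j / N : ℝ) ^ 2 / (2 * σ ^ 2) := by
    field_simp
    ring
  rw [e1]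
  rcases hj.eq_or_lt with rfl | hj
  · have h1 := rate_le_costFun (q := q) (σ := σ) (C := C) hε1 (t := 1) (by simp)
    rw [costFun_one hε1] at h1
    have h2 : 0 ≤ q' * (max (1 - ((j + 1 : ℕ) : ℝ) / j) 0) ^ (1 - ε) / C ^ (1 + ε) := by
      positivity
    rw [div_self hN'.ne', one_pow]
    linarith
  · have hj1 : ((j + 1 : ℕ) : ℝ) ≤ N := by exact_mod_cast hj
    set t : ℝ := ((j + 1 : ℕ) : ℝ) / N with ht
    have ht1 : t ≤ 1 := by rw [ht, div_le_one hN']; exact hj1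
    have ht0 : 0 ≤ t := by positivity
    have hjt : (j / N : ℝ) = t - 1 / N := by
      rw [ht]; push_cast; field_simp; ring
    rw [max_eq_left (by linarith)]
    have h1 := rate_le_costFun (q := q) (σ := σ) (C := C) hε1 (t := t) ⟨ht0, ht1⟩
    rw [costFun] at h1
    have hp1 : (1 - t) ^ (1 - ε) ≤ 1 :=
      Real.rpow_le_one (by linarith) (by linarith) (by linarith)
    have hp0 : 0 ≤ (1 - t) ^ (1 - ε) := Real.rpow_nonneg (by linarith) _
    have h2 : q * (1 - t) ^ (1 - ε) / C ^ (1 + ε) ≤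
        q' * (1 - t) ^ (1 - ε) / C ^ (1 + ε) + d := by
      have e : q * (1 - t) ^ (1 - ε) / C ^ (1 + ε) = q' * (1 - t) ^ (1 - ε) / C ^ (1 + ε) +
          (q - q') / C ^ (1 + ε) * (1 - t) ^ (1 - ε) := by ring
      rw [e]
      have := mul_le_mul_of_nonneg_right hqd hp0
      nlinarith
    have h3 : t ^ 2 / (2 * σ ^ 2) ≤ (j / N : ℝ) ^ 2 / (2 * σ ^ 2) + d := by
      have e : t ^ 2 / (2 * σ ^ 2) - (j / N : ℝ) ^ 2 / (2 * σ ^ 2) =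
          (t - 1 / (2 * N)) * (1 / (N * σ ^ 2)) := by
        rw [hjt]; field_simp; ring
      have hle : (t - 1 / (2 * N)) * (1 / (N * σ ^ 2)) ≤ 1 * (1 / (N * σ ^ 2)) :=
        mul_le_mul_of_nonneg_right
          (by have : (0 : ℝ) < 1 / (2 * N) := by positivity
              linarith) (by positivity)
      linarith
    linarith

lemma eventually_sumTail_le_exp (hindep : iIndepFun Y P)
    (hident : ∀ i, IdentDistrib (Y i) (Y 0) P P) (hL2 : MemLp (Y 0) 2 P)
    (h0 : ∫ ω, Y 0 ω ∂P = 0) (hvar : variance (Y 0) P = σ ^ 2) (hσ : σ ≠ 0)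
    (hε0 : 0 < ε) (hε1 : ε < 1) (hq : 0 < q) (hC : 0 < C)
    (htail : (fun x : ℝ => Real.log (P.real {ω | x ≤ Y 0 ω}))
      ~[atTop] (fun x : ℝ => -q * x ^ (1 - ε)))
    {c : ℝ} (hc : c < rate ε q σ C) :
    ∀ᶠ n : ℕ in atTop, sumTail P Y n (level ε C n) ≤ Real.exp (-c * speed ε C n) := by
  obtain ⟨d, hd, hdc⟩ : ∃ d > 0, c + 4 * d = rate ε q σ C :=
    ⟨(rate ε q σ C - c) / 4, by linarith, by ring⟩
  have hCp : 0 < C ^ (1 + ε) := Real.rpow_pos_of_pos hC _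
  obtain ⟨q', hq'0, hqq, hqd⟩ : ∃ q' > 0, q' < q ∧ (q - q') / C ^ (1 + ε) ≤ d := by
    refine ⟨max (q / 2) (q - d * C ^ (1 + ε)), lt_max_of_lt_left (by linarith),
      max_lt (by linarith) (by nlinarith), ?_⟩
    rw [div_le_iff₀ hCp]
    linarith [le_max_right (q / 2) (q - d * C ^ (1 + ε))]
  obtain ⟨r, hr1, hr2⟩ := exists_between hqq
  have htail' := eventually_le_exp_of_log_isEquivalent (fun _ => measureReal_nonneg) htail hr2
  obtain ⟨N, hNpos, hNd⟩ : ∃ N : ℕ, 0 < N ∧ 1 / (N * σ ^ 2) ≤ d := by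
    obtain ⟨N, hN⟩ := exists_nat_gt (1 / (d * σ ^ 2))
    have hN0 : (0 : ℝ) < N := lt_trans (by positivity) hN
    refine ⟨N, by exact_mod_cast hN0, ?_⟩
    rw [div_lt_iff₀ (by positivity)] at hN
    rw [div_le_iff₀ (by positivity)]
    nlinarith
  have hN' : (0 : ℝ) < N := by exact_mod_cast hNpos
  obtain ⟨η, hη, hηq⟩ : ∃ η > 0, 1 / σ ^ 2 * (η ^ ε * C ^ (1 + ε)) ≤ q' := by
    refine ⟨(q' * σ ^ 2 / C ^ (1 + ε)) ^ ε⁻¹, by positivity, le_of_eq ?_⟩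
    rw [← Real.rpow_mul (by positivity), inv_mul_cancel₀ hε0.ne', Real.rpow_one]
    field_simp
  have hcell : ∀ j ∈ Finset.range (N + 1), ∀ᶠ n : ℕ in atTop, P.real {ω |
        1 / σ ^ 2 * (j / N) * (j / N * level ε C n) ≤
          1 / σ ^ 2 * (j / N) * smallSum Y n (η * level ε C n) ω ∧
        max (1 - ((j + 1 : ℕ) : ℝ) / N) 0 * level ε C n ≤ bigSum Y n (η * level ε C n) ω} ≤
      Real.exp (-(c + d) * speed ε C n) := by
    intro j hj
    have hjN : j ≤ N := by have := Finset.mem_range.1 hj; omega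
    have hj1 : (j / N : ℝ) ≤ 1 := by
      rw [div_le_one hN']
      exact_mod_cast hjN
    have hηj : 1 / σ ^ 2 * (j / N : ℝ) * (η ^ ε * C ^ (1 + ε)) ≤ q' := by
      refine le_trans ?_ hηq
      refine mul_le_mul_of_nonneg_right ?_ (by positivity)
      exact mul_le_of_le_one_right (by positivity) hj1
    filter_upwards [eventually_measureReal_smallSum_bigSum_le hindep hident hL2 h0 hvar hε0 hε1 hC
      hq'0.le hr1 htail' hη (θ := 1 / σ ^ 2 * (j / N)) (by positivity) hηj hd (j / N)
      (b := max (1 - ((j + 1 : ℕ) : ℝ) / N) 0) (le_max_right _ _), eventually_gt_atTop 0]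
      with n h1 hn
    refine h1.trans (Real.exp_le_exp.2 ?_)
    refine mul_le_mul_of_nonneg_right ?_ (speed_pos hC hn).le
    have := rate_sub_le_cell_exponent (q := q) hε1 hσ hC hq'0.le hd.le hqd hNpos hNd hjN
    linarith
  have hall := (Finset.range (N + 1)).eventually_all.2 hcell
  filter_upwards [hall, (tendsto_speed hε0 hε1 hC).eventually_ge_atTop (Real.log (N + 1) / d),
    eventually_gt_atTop 0] with n h1 h2 hn
  have hx := level_pos (ε := ε) hC hn
  rw [div_le_iff₀ hd] at h2
  calc sumTail P Y n (level ε C n)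
      ≤ P.real (⋃ j ∈ Finset.range (N + 1), {ω |
        1 / σ ^ 2 * (j / N) * (j / N * level ε C n) ≤
          1 / σ ^ 2 * (j / N) * smallSum Y n (η * level ε C n) ω ∧
        max (1 - ((j + 1 : ℕ) : ℝ) / N) 0 * level ε C n ≤
          bigSum Y n (η * level ε C n) ω}) := by
        refine measureReal_mono (fun ω (hω : level ε C n ≤ _) => ?_) (measure_ne_top _ _)
        rw [← smallSum_add_bigSum (z := η * level ε C n)] at hω
        obtain ⟨j, hj, hcov⟩ := exists_cell hNpos hx (θ := 1 / σ ^ 2) (by positivity)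
          (bigSum_nonneg (by positivity)) hω
        exact Set.mem_biUnion (Finset.mem_coe.2 hj) hcov
    _ ≤ ∑ _j ∈ Finset.range (N + 1), Real.exp (-(c + d) * speed ε C n) :=
        (measureReal_biUnion_finset_le _ _).trans (Finset.sum_le_sum h1)
    _ = Real.exp (Real.log (N + 1)) * Real.exp (-(c + d) * speed ε C n) := by
        rw [Real.exp_log (by positivity)]; simp
    _ ≤ Real.exp (-c * speed ε C n) := by
        rw [← Real.exp_add, Real.exp_le_exp]
        linarith

end UpperBound

/-! ### Conclusion -/

/-- Matching exponential bounds on `F` at speed `L` give the limit of `log F / L`. -/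
lemma tendsto_log_div_of_exp_bounds {F L : ℕ → ℝ} {J : ℝ} (hL : ∀ᶠ n in atTop, 0 < L n)
    (hlow : ∀ c, J < c → ∀ᶠ n in atTop, Real.exp (-c * L n) ≤ F n)
    (hup : ∀ c, c < J → ∀ᶠ n in atTop, F n ≤ Real.exp (-c * L n)) :
    Tendsto (fun n => Real.log (F n) / L n) atTop (𝓝 (-J)) := by
  have hpos : ∀ᶠ n in atTop, 0 < F n := by
    filter_upwards [hlow (J + 1) (by linarith)] with n hn
    exact (Real.exp_pos _).trans_le hn
  refine tendsto_order.2 ⟨fun a ha => ?_, fun a ha => ?_⟩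
  · obtain ⟨b, hab, hb⟩ := exists_between ha
    filter_upwards [hL, hlow (-b) (by linarith), hpos] with n h1 h2 h3
    rw [lt_div_iff₀ h1]
    rw [neg_neg, ← Real.le_log_iff_exp_le h3] at h2
    nlinarith
  · obtain ⟨b, hb, hab⟩ := exists_between ha
    filter_upwards [hL, hup (-b) (by linarith), hpos] with n h1 h2 h3
    rw [div_lt_iff₀ h1]
    rw [neg_neg, ← Real.log_le_iff_le_exp h3] at h2
    nlinarith

/-- A random variable with zero variance is almost surely equal to its mean `0`, which is
incompatible with a tail of Weibull type. -/
lemma variance_ne_zero_of_tail {Ω : Type*} [MeasurableSpace Ω] {P : Measure Ω}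
    [IsProbabilityMeasure P] {X : Ω → ℝ} {ε q : ℝ} (hX : MemLp X 2 P) (h0 : ∫ ω, X ω ∂P = 0)
    (hq : 0 < q) (htail : (fun x : ℝ => Real.log (P.real {ω | x ≤ X ω}))
      ~[atTop] (fun x : ℝ => -q * x ^ (1 - ε))) : variance X P ≠ 0 := by
  intro hv
  have hae := ae_eq_integral_of_variance_eq_zero hX hv
  rw [h0] at hae
  obtain ⟨x, hx, hx0⟩ := ((eventually_exp_le_of_log_isEquivalent (fun _ => measureReal_nonneg) hq
    htail (lt_add_one q)).and (eventually_gt_atTop 0)).exists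
  have hz : P.real {ω | x ≤ X ω} = 0 := by
    rw [measureReal_eq_zero_iff]
    refine measure_mono_null (fun ω (hω : x ≤ X ω) => ?_) (ae_iff.1 hae)
    change ¬ X ω = 0
    linarith
  rw [hz] at hx
  exact absurd hx (not_le.2 (Real.exp_pos _))

end WeibullLD

theorem theorem3
    {Ω₀ : Type*} [MeasurableSpace Ω₀] (P₀ : Measure Ω₀) [IsProbabilityMeasure P₀]
    {Ω : Type*} [MeasurableSpace Ω] (P : Measure Ω) [IsProbabilityMeasure P]
    (X : Ω₀ → ℝ) (hX : AEMeasurable X P₀)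
    (ε q σ γ : ℝ) (hε0 : 0 < ε) (hε1 : ε < 1) (hq : 0 < q) (hγ : 0 < γ)
    (htail : (fun x : ℝ => Real.log (P₀.real {ω | x ≤ X ω}))
      ~[atTop] (fun x : ℝ => -q * x ^ (1 - ε)))
    (hmoment : Integrable (fun ω => |X ω| ^ (2 + γ)) P₀)
    (hcentered : ∫ ω, X ω ∂P₀ = 0)
    (hσ : variance X P₀ = σ ^ 2)
    (Y : ℕ → Ω → ℝ) (hindep : iIndepFun Y P)
    (hident : ∀ i, IdentDistrib (Y i) X P P₀)
    (C : ℝ) (hC : 0 < C) :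
    Tendsto
      (fun n : ℕ => (n : ℝ) / (WeibullLD.level ε C n) ^ 2 *
        Real.log (P.real {ω | WeibullLD.level ε C n ≤ ∑ i ∈ Finset.range n, Y i ω}))
      atTop (𝓝 (-WeibullLD.rate ε q σ C))
    ∧ (C ≤ WeibullLD.critConst ε q σ → WeibullLD.rate ε q σ C = 1 / (2 * σ ^ 2))
    ∧ (WeibullLD.critConst ε q σ < C →
        ∃ t₁ t₂ : ℝ, t₁ < t₂ ∧ WeibullLD.critRoots ε q σ C = {t₁, t₂} ∧
          WeibullLD.rate ε q σ C = WeibullLD.costFun ε q σ C t₁) := by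
  have hXL2 : MemLp X 2 P₀ := by
    have h : MemLp X (ENNReal.ofReal (2 + γ)) P₀ := by
      rw [← integrable_norm_rpow_iff hX.aestronglyMeasurable (by simp; linarith) (by simp),
        ENNReal.toReal_ofReal (by linarith)]
      simpa using hmoment
    refine h.mono_exponent ?_
    rw [← ENNReal.ofReal_ofNat]
    exact ENNReal.ofReal_le_ofReal (by linarith)
  have hσ0 : σ ≠ 0 := by
    rintro rfl
    exact WeibullLD.variance_ne_zero_of_tail hXL2 hcentered hq htail (by simpa using hσ)
  have hid i : IdentDistrib (Y i) (Y 0) P P := (hident i).trans (hident 0).symm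
  have hL2 : MemLp (Y 0) 2 P := (hident 0).memLp_iff.2 hXL2
  have hmean : ∫ ω, Y 0 ω ∂P = 0 := by rw [(hident 0).integral_eq, hcentered]
  have hvar : variance (Y 0) P = σ ^ 2 := by rw [(hident 0).variance_eq, hσ]
  have htailY : (fun x : ℝ => Real.log (P.real {ω | x ≤ Y 0 ω}))
      ~[atTop] (fun x : ℝ => -q * x ^ (1 - ε)) := by
    have h : ∀ x : ℝ, P.real {ω | x ≤ Y 0 ω} = P₀.real {ω | x ≤ X ω} := fun x =>
      congrArg ENNReal.toReal ((hident 0).measure_mem_eq (measurableSet_Ici (a := x)))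
    simpa only [h] using htail
  refine ⟨?_, WeibullLD.rate_eq_of_le_critConst hε0 hε1 hq hσ0 hC,
    WeibullLD.exists_critRoots_eq_pair hε0 hε1 hq hσ0 hC⟩
  have hlim := WeibullLD.tendsto_log_div_of_exp_bounds (L := WeibullLD.speed ε C)
    (F := fun n => WeibullLD.sumTail P Y n (WeibullLD.level ε C n))
    ((eventually_gt_atTop 0).mono fun n hn => WeibullLD.speed_pos hC hn)
    (fun c hc => WeibullLD.eventually_exp_le_sumTail hindep hid hL2 hmean hvar hσ0 hε0 hε1 hq hC
      htailY hc)
    (fun c hc => WeibullLD.eventually_sumTail_le_exp hindep hid hL2 hmean hvar hσ0 hε0 hε1 hq hC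
      htailY hc)
  refine hlim.congr fun n => ?_
  rw [WeibullLD.speed, WeibullLD.sumTail, div_eq_inv_mul, inv_div]
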